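/- Let $t\ge 3$ be odd. A $t$-Schur overpartition of $n\ge 0$ is an overpartition of $n$ (a partition of $n$ in which the first occurrence of each distinct part may be overlined) all of whose parts are congruent modulo $2t$ to an element of $\{1,3,5,\dots,2t-1\}\setminus\{t\}$. Let $\overline{S_t}(n)$ denote the number of $t$-Schur overpartitions of $n$ and, for $r\ge 1$, let $\overline{S_t}^{\,r}(n)$ denote the number of $r$-tuples of $t$-Schur overpartitions whose sizes add up to $n$; equivalently, \[ \sum_{n\ge 0}\overline{S_t}^{\,r}(n)q^n=\prod_{k\ge 1}\left(\frac{(1+q^{2k-1})(1-q^{t(2k-1)})}{(1+q^{t(2k-1)})(1-q^{2k-1})}\right)^{r},\qquad \overline{S_t}=\overline{S_t}^{\,1}. \] Let $p\ge 5$ be a prime, let $\left(\frac{\cdot}{p}\right)$ be the Legendre symbol, and let $\alpha,m,n\ge 0$ and $1\le i\le p-1$ be integers. Then: 1. If $p\equiv 5\pmod 6$, then $\overline{S_9}\big(6p^{2\alpha+2}n+(6i+3p)p^{2\alpha+1}\big)\equiv 0\pmod 3$. 2. If $\left(\frac{-18}{p}\right)=-1$, then $\overline{S_9}^{\,16m+1}\big(24p^{2\alpha+2}n+(24i+11p)p^{2\alpha+1}\big)\equiv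 0\pmod{32}$. 3. If $\left(\frac{-3}{p}\right)=-1$, then $\overline{S_9}^{\,8m+1}\big(18p^{2\alpha+2}n+3(6i+p)p^{2\alpha+1}\big)\equiv 0\pmod{16}$. 4. If $\left(\frac{-9}{p}\right)=-1$, then $\overline{S_9}^{\,8m+1}\big(12p^{2\alpha+2}n+(12i+5p)p^{2\alpha+1}\big)\equiv 0\pmod{16}$. 5. If $\left(\frac{-3}{p}\right)=-1$, then $\overline{S_9}^{\,4m+1}\big(6p^{2\alpha+2}n+(6i+p)p^{2\alpha+1}\big)\equiv 0\pmod 8$. -/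

import Mathlib

/-- The set of residues `I(t) = {1, 3, 5, …, 2t - 1} \ {t}` modulo `2t`. -/
def schurResidues (t : ℕ) : Finset ℕ :=
  (Finset.range (2 * t)).filter fun i => Odd i ∧ i ≠ t

/-- The `t`-Schur partitions of `n`: every part is congruent modulo `2t` to an element of
`I(t)`. -/
def schurPartitions (t n : ℕ) : Finset n.Partition :=
  Finset.univ.filter fun μ => ∀ a ∈ μ.parts, a % (2 * t) ∈ schurResidues t

/-- The `t`-Schur overpartitions of `n`: a `t`-Schur partition of `n` together with the set of
those part sizes whose first occurrence is overlined. -/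
def schurOverpartitions (t n : ℕ) : Finset ((_ : n.Partition) × Finset ℕ) :=
  (schurPartitions t n).sigma fun μ => μ.parts.toFinset.powerset

/-- The ordered `r`-tuples of `t`-Schur overpartitions of total size `n`: a tuple of sizes
`k₁, …, k_r` with sum `n`, and for each `j` a `t`-Schur overpartition of `k_j`. -/
def schurOverpartitionTuples (t r n : ℕ) :
    Finset ((k : Fin r → ℕ) × ((j : Fin r) → (_ : (k j).Partition) × Finset ℕ)) :=
  (Finset.Nat.antidiagonalTuple r n).sigma fun k =>
    Fintype.piFinset fun j => schurOverpartitions t (k j)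

/-- The number of `t`-Schur overpartitions of `n`. -/
def numSchurOverpartitions (t n : ℕ) : ℕ :=
  (schurOverpartitions t n).card

/-- The number of `r`-tuples of `t`-Schur overpartitions of total size `n`. -/
def numSchurOverpartitionTuples (t r n : ℕ) : ℕ :=
  (schurOverpartitionTuples t r n).card

/-! ### Series with quadratic exponents and their sections along progressions -/

open PowerSeries
open scoped PowerSeries.WithPiTopology

/-! Write φ(±q) = `theta (±1) 1 1`, ψ(q) = `theta 1 1 3`, E(q) = `theta (-1) 1 2` (Euler's product),
and f(sq^b, sq^c) = `theta s b c`. The generating function is F = φ(q)φ(-q^18) / (φ(q^9)φ(-q^2)).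
The 3-dissection of φ gives F = (1 + 2qU(q^3)) / (1 - 2q^2 V(q^6)), with U = f(q,q^5)/φ(q^3) and V =
f(-q,-q^5)/φ(-q^3) (`schurSeries_nine_identity`).

Rationalising the denominator to 1 - 8q^6 V(q^6)^3 makes the sections at 6n+1, 6n+3, 6n+5 explicit:
up to the common factor 1/(1 - 8qV^3) they are 2W, 4WV, 8WV^2, where W is the even part of U and W =
E(q^2)^2/φ(-q^3)^2 (`exists_progSection_schurSeries_nine`). Since φ ≡ 1 mod 2, even powers of
φ(-q^3) disappear modulo powers of 2; modulo 3, cubing acts as q ↦ q^3. Product identities then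
reduce each section, modulo 3, 8, 16 or 32, to a constant times a product of two theta functions (in
one case evaluated at q^2).

The exponents in such a product are, after completing squares, values of x^2 + Dy^2 with D = 3, 9 or
18. In the stated progressions this value would be c p^(2α+1) with p not dividing c, which descent
excludes when -D is a nonresidue (`sq_add_mul_sq_ne`), so the coefficient vanishes. Finally F ≡ 1
mod 2 gives F^(2^k m + 1) ≡ F mod 2^(k+1), which passes from single overpartitions to tuples.

All theta identities come either from the Jacobi triple product (`theta_eq_pochProd`) or from a
bijection of index sets (`IsThetaSum.eq_of_bijective`). -/

/-- `A` is the power series `∑ i, w i * X ^ e i`, with nonnegative integer exponents `e i`. -/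
structure IsThetaSum {ι : Type*} (e w : ι → ℤ) (A : ℤ⟦X⟧) : Prop where
  nonneg : ∀ i, 0 ≤ e i
  hasSum : ∀ d : ℕ, HasSum (fun i => if e i = d then w i else 0) (coeff d A)

/-- The arithmetic progression section `∑ n, A_{a n + r} X ^ n` of a power series. -/
noncomputable def progSection (a r : ℕ) : ℤ⟦X⟧ →ₗ[ℤ] ℤ⟦X⟧ where
  toFun A := mk fun n => coeff (a * n + r) A
  map_add' A B := by ext n; simp
  map_smul' c A := by
    ext n
    simp only [coeff_mk, RingHom.id_apply, map_zsmul]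

@[simp]
theorem coeff_progSection (a r n : ℕ) (A : ℤ⟦X⟧) :
    coeff n (progSection a r A) = coeff (a * n + r) A := by
  simp [progSection]

theorem progSection_comp (a r b s : ℕ) (A : ℤ⟦X⟧) :
    progSection b s (progSection a r A) = progSection (a * b) (a * s + r) A := by
  ext n; simp only [coeff_progSection]; ring_nf

theorem progSection_X_mul (a r : ℕ) (A : ℤ⟦X⟧) :
    progSection a (r + 1) (X * A) = progSection a r A := by
  ext n; rw [coeff_progSection, ← add_assoc, coeff_succ_X_mul, coeff_progSection]

theorem progSection_X_mul_zero {a : ℕ} (ha : 0 < a) (A : ℤ⟦X⟧) :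
    progSection a 0 (X * A) = X * progSection a (a - 1) A := by
  ext n
  rcases n with _ | n
  · simp
  · rw [coeff_progSection, coeff_succ_X_mul, coeff_progSection]
    obtain ⟨b, rfl⟩ := Nat.exists_eq_succ_of_ne_zero ha.ne'
    rw [show (b.succ) * (n + 1) + 0 = (b.succ * n + b) + 1 by
      simp only [Nat.succ_eq_add_one]; ring,
      coeff_succ_X_mul]
    simp

/-- A series in X ^ a does not mix residue classes modulo a, so it factors out of a section. This is
how denominators and already dissected factors are moved through `progSection`. -/
theorem progSection_mul_expand {a : ℕ} (ha : a ≠ 0) {r : ℕ} (hr : r < a) (A B : ℤ⟦X⟧) :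
    progSection a r (A * expand a ha B) = progSection a r A * B := by
  ext n
  rw [coeff_progSection, coeff_mul, coeff_mul]
  have ha' : 0 < a := Nat.pos_of_ne_zero ha
  symm
  apply Finset.sum_of_injOn (fun p : ℕ × ℕ => (a * p.1 + r, a * p.2))
  · rintro ⟨x, y⟩ _ ⟨x', y'⟩ _ h
    simp only [Prod.mk.injEq] at h ⊢
    exact ⟨Nat.eq_of_mul_eq_mul_left ha' (by omega), Nat.eq_of_mul_eq_mul_left ha' h.2⟩
  · rintro ⟨x, y⟩ h
    rw [Finset.mem_coe, Finset.HasAntidiagonal.mem_antidiagonal] at h ⊢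
    rw [← h]; ring
  · rintro ⟨x, y⟩ h h'
    rw [Finset.HasAntidiagonal.mem_antidiagonal] at h
    dsimp only at h
    by_cases hy : a ∣ y
    · exfalso
      apply h'
      obtain ⟨y, rfl⟩ := hy
      have hy : y ≤ n := by
        by_contra hlt
        have : a * (n + 1) ≤ a * y := Nat.mul_le_mul_left _ (by omega)
        rw [Nat.mul_add] at this
        omega
      refine ⟨(n - y, y), by simp [hy], ?_⟩
      obtain ⟨k, rfl⟩ := Nat.exists_eq_add_of_le hy
      simp only [Prod.mk.injEq, and_true, Nat.add_sub_cancel_left]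
      rw [Nat.mul_add] at h
      omega
    · rw [coeff_expand_of_not_dvd _ _ _ hy, mul_zero]
  · rintro ⟨x, y⟩ _
    simp

theorem progSection_expand {a : ℕ} (ha : a ≠ 0) (B : ℤ⟦X⟧) :
    progSection a 0 (expand a ha B) = B := by
  ext n; simp

theorem progSection_expand_of_pos {a : ℕ} (ha : a ≠ 0) {r : ℕ} (hr : r < a) (hr0 : 0 < r)
    (B : ℤ⟦X⟧) : progSection a r (expand a ha B) = 0 := by
  ext n
  rw [coeff_progSection, coeff_expand_of_not_dvd]
  · simp
  · intro h
    rw [Nat.dvd_add_right (dvd_mul_right _ _)] at h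
    exact absurd (Nat.le_of_dvd hr0 h) (by omega)

namespace IsThetaSum

variable {ι κ : Type*} {e w : ι → ℤ} {e' w' : κ → ℤ} {A B : ℤ⟦X⟧}

theorem eq_of_bijective (hA : IsThetaSum e w A) (hB : IsThetaSum e' w' B) (σ : κ → ι)
    (hσ : σ.Bijective) (he : ∀ k, e (σ k) = e' k) (hw : ∀ k, w (σ k) = w' k) : A = B := by
  ext d
  refine HasSum.unique ?_ (hB.hasSum d)
  have := ((Equiv.ofBijective σ hσ).hasSum_iff).mpr (hA.hasSum d)
  simpa [Function.comp_def, he, hw] using this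

theorem add (hA : IsThetaSum e w A) (hB : IsThetaSum e' w' B) :
    IsThetaSum (Sum.elim e e') (Sum.elim w w') (A + B) where
  nonneg := by rintro (i | i); exacts [hA.nonneg i, hB.nonneg i]
  hasSum d := by
    rw [map_add]
    have h1 := hA.hasSum d
    have h2 := hB.hasSum d
    have i1 : HasSum (Sum.elim (fun i => if e i = d then w i else 0) (fun _ : κ => (0 : ℤ)))
        (coeff d A) := by
      rw [← Function.Injective.hasSum_iff (Sum.inl_injective (α := ι) (β := κ))]
      · exact h1
      · rintro (i | i) hi
        · exact absurd ⟨i, rfl⟩ hi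
        · rfl
    have i2 : HasSum (Sum.elim (fun _ : ι => (0 : ℤ)) (fun i => if e' i = d then w' i else 0))
        (coeff d B) := by
      rw [← Function.Injective.hasSum_iff (Sum.inr_injective (α := ι) (β := κ))]
      · exact h2
      · rintro (i | i) hi
        · rfl
        · exact absurd ⟨i, rfl⟩ hi
    convert i1.add i2 using 1
    ext (i | i)
    exacts [(add_zero _).symm, (zero_add _).symm]

theorem C_mul (hA : IsThetaSum e w A) (c : ℤ) : IsThetaSum e (fun i => c * w i) (C c * A) where
  nonneg := hA.nonneg
  hasSum d := by
    rw [coeff_C_mul]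
    simpa only [mul_ite, mul_zero] using (hA.hasSum d).mul_left c

theorem neg (hA : IsThetaSum e w A) : IsThetaSum e (fun i => - w i) (-A) := by
  simpa using hA.C_mul (-1)

theorem X_pow_mul (hA : IsThetaSum e w A) (j : ℕ) :
    IsThetaSum (fun i => e i + j) w (X ^ j * A) where
  nonneg i := by have := hA.nonneg i; positivity
  hasSum d := by
    rw [coeff_X_pow_mul']
    split_ifs with h
    · convert hA.hasSum (d - j) using 2 with i
      congr 1
      simp only [eq_iff_iff]
      omega
    · convert hasSum_zero with i
      rw [if_neg]
      have := hA.nonneg i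
      omega

theorem expand (hA : IsThetaSum e w A) (k : ℕ) (hk : k ≠ 0) :
    IsThetaSum (fun i => k * e i) w (PowerSeries.expand k hk A) where
  nonneg i := by have := hA.nonneg i; positivity
  hasSum d := by
    rw [coeff_expand]
    have hk' : (k : ℤ) ≠ 0 := by exact_mod_cast hk
    split_ifs with h
    · obtain ⟨d, rfl⟩ := h
      rw [Nat.mul_div_cancel_left _ (Nat.pos_of_ne_zero hk)]
      convert hA.hasSum d using 2 with i
      simp [hk]
    · convert hasSum_zero with i
      rw [if_neg]
      intro hd
      exact h (Int.natCast_dvd_natCast.mp ⟨e i, hd.symm⟩)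

theorem mul (hA : IsThetaSum e w A) (hB : IsThetaSum e' w' B) :
    IsThetaSum (fun i : ι × κ => e i.1 + e' i.2) (fun i => w i.1 * w' i.2) (A * B) where
  nonneg i := add_nonneg (hA.nonneg _) (hB.nonneg _)
  hasSum d := by
    rw [coeff_mul]
    have key : ∀ x ∈ Finset.HasAntidiagonal.antidiagonal d, HasSum (fun i : ι × κ =>
        (if e i.1 = x.1 then w i.1 else 0) * (if e' i.2 = x.2 then w' i.2 else 0))
        (coeff x.1 A * coeff x.2 B) := by
      intro x _
      have h1 := hA.hasSum x.1
      have h2 := hB.hasSum x.2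
      refine h1.mul h2 (summable_of_hasFiniteSupport ?_)
      refine ((h1.summable.hasFiniteSupport_of_discreteTopology).prod
        (h2.summable.hasFiniteSupport_of_discreteTopology)).subset ?_
      rintro ⟨i, j⟩ h
      exact ⟨left_ne_zero_of_mul h, right_ne_zero_of_mul h⟩
    convert hasSum_sum key using 1
    ext ⟨i, j⟩
    obtain ⟨m, hm⟩ := Int.eq_ofNat_of_zero_le (hA.nonneg i)
    obtain ⟨n, hn⟩ := Int.eq_ofNat_of_zero_le (hB.nonneg j)
    simp only [hm, hn, Nat.cast_inj]
    by_cases h : m + n = d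
    · rw [if_pos (by exact_mod_cast h), Finset.sum_eq_single (m, n)]
      · simp
      · rintro ⟨a, b⟩ _ hab
        by_cases h1 : m = a
        · rw [if_neg (fun h2 : n = b => hab (by rw [h1, h2])), mul_zero]
        · rw [if_neg h1, zero_mul]
      · intro h'
        exact absurd (by simpa using h) h'
    · rw [if_neg (by exact_mod_cast h), Finset.sum_eq_zero]
      rintro ⟨a, b⟩ hab
      rw [Finset.HasAntidiagonal.mem_antidiagonal] at hab
      by_cases h1 : m = a
      · rw [if_neg (fun h2 : n = b => h (by rw [h1, h2]; exact hab)), mul_zero]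
      · rw [if_neg h1, zero_mul]

/-- Here `g` parametrises exactly the indices whose exponent lies in the class of r modulo a. -/
theorem progSection {a r : ℕ} (hA : IsThetaSum e w A) (hr : r < a) (g : κ → ι)
    (hg : g.Injective) (he : ∀ k, e (g k) = a * e' k + r)
    (hrange : ∀ i (d : ℤ), e i = a * d + r → i ∈ Set.range g) :
    IsThetaSum e' (fun k => w (g k)) (progSection a r A) where
  nonneg k := by
    have h1 := hA.nonneg (g k)
    rw [he] at h1
    by_contra! h
    have : (a : ℤ) * e' k ≤ a * (-1) := by gcongr; omega
    omega
  hasSum d := by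
    rw [coeff_progSection]
    have := (hg.hasSum_iff (f := fun i => if e i = (a * d + r : ℕ) then w i else 0)
      (a := coeff (a * d + r) A) ?_).mpr (hA.hasSum _)
    · convert this using 2 with k
      simp only [Function.comp_apply, he]
      push_cast
      congr 1
      have : (a : ℤ) ≠ 0 := by omega
      simp [show a ≠ 0 by omega]
    · intro i hi
      rw [if_neg]
      intro h
      exact hi (hrange i d (by rw [h]; push_cast; ring))

theorem coeff_eq_zero (hA : IsThetaSum e w A) {d : ℕ} (h : ∀ i, e i ≠ d) : coeff d A = 0 :=
  (hA.hasSum d).unique (by simp [h])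

end IsThetaSum

/-! ### Ramanujan's theta function as a power series -/

/-- The exponent `b * n (n + 1) / 2 + c * n (n - 1) / 2` of Ramanujan's theta function. -/
def thetaExp (b c : ℕ) (n : ℤ) : ℤ :=
  b * (n * (n + 1) / 2) + c * (n * (n - 1) / 2)

/-- Ramanujan's theta function `f(s X ^ b, s X ^ c)` for a sign `s`. -/
noncomputable def theta (s : ℤˣ) (b c : ℕ) : ℤ⟦X⟧ :=
  mk fun d => ∑ n ∈ Finset.Icc (-d : ℤ) d, if thetaExp b c n = d then ((s ^ n : ℤˣ) : ℤ) else 0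

theorem two_mul_thetaExp (b c : ℕ) (n : ℤ) :
    2 * thetaExp b c n = (b + c) * n ^ 2 + (b - c) * n := by
  have h1 : 2 * (n * (n + 1) / 2) = n * (n + 1) :=
    Int.mul_ediv_cancel' (Int.even_mul_succ_self n).two_dvd
  have h2 : 2 * (n * (n - 1) / 2) = n * (n - 1) :=
    Int.mul_ediv_cancel' (Int.even_mul_pred_self n).two_dvd
  unfold thetaExp
  linear_combination (b : ℤ) * h1 + (c : ℤ) * h2

/-- Shows that the finite range in `theta` loses no term, and later controls the truncation error in
the triple product. Both triangular parts are nonnegative, so the case b = c = 1, where the exponent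
is n ^ 2, is the worst. -/
theorem abs_le_thetaExp {b c : ℕ} (hb : 0 < b) (hc : 0 < c) (n : ℤ) : |n| ≤ thetaExp b c n := by
  have h := two_mul_thetaExp b c n
  have hb' : (1 : ℤ) ≤ b := by exact_mod_cast hb
  have hc' : (1 : ℤ) ≤ c := by exact_mod_cast hc
  have h1 : 0 ≤ n * (n + 1) := by
    rcases le_or_gt 0 n with h | h
    · positivity
    · exact mul_nonneg_of_nonpos_of_nonpos h.le (by omega)
  have h2 : 0 ≤ n * (n - 1) := by
    rcases lt_or_ge 0 n with h | h
    · exact mul_nonneg h.le (by omega)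
    · exact mul_nonneg_of_nonpos_of_nonpos h (by omega)
  have h3 : |n| ≤ n ^ 2 := by
    rw [abs_le]
    constructor <;> linarith
  nlinarith [mul_nonneg (sub_nonneg.mpr hb') h1, mul_nonneg (sub_nonneg.mpr hc') h2]

theorem isThetaSum_theta (s : ℤˣ) {b c : ℕ} (hb : 0 < b) (hc : 0 < c) :
    IsThetaSum (thetaExp b c) (fun n => ((s ^ n : ℤˣ) : ℤ)) (theta s b c) where
  nonneg n := (abs_nonneg n).trans (abs_le_thetaExp hb hc n)
  hasSum d := by
    rw [theta, coeff_mk]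
    apply hasSum_sum_of_ne_finset_zero
    intro n hn
    rw [if_neg]
    intro h
    apply hn
    rw [Finset.mem_Icc, ← abs_le, ← h]
    exact abs_le_thetaExp hb hc n

/-! ### The finite triple product -/

section GaussBinom

variable {R : Type*} [CommRing R]

/-- The Gaussian binomial coefficient with parameter `w`. -/
def gaussBinom (w : R) : ℕ → ℕ → R
  | _, 0 => 1
  | 0, _ + 1 => 0
  | n + 1, k + 1 => gaussBinom w n k + w ^ (k + 1) * gaussBinom w n (k + 1)

theorem gaussBinom_zero_right (w : R) (n : ℕ) : gaussBinom w n 0 = 1 := by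
  cases n <;> rfl

theorem gaussBinom_succ_succ (w : R) (n k : ℕ) :
    gaussBinom w (n + 1) (k + 1) = gaussBinom w n k + w ^ (k + 1) * gaussBinom w n (k + 1) := rfl

theorem gaussBinom_eq_zero (w : R) {n k : ℕ} (h : n < k) : gaussBinom w n k = 0 := by
  induction n generalizing k with
  | zero => obtain ⟨k, rfl⟩ := Nat.exists_eq_succ_of_ne_zero h.ne'; rfl
  | succ n ih =>
    obtain ⟨k, rfl⟩ := Nat.exists_eq_succ_of_ne_zero (by omega : k ≠ 0)
    rw [Nat.succ_eq_add_one, gaussBinom_succ_succ, ih (by omega), ih (by omega)]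
    ring

/-- The `q`-binomial theorem. -/
theorem prod_add_mul_pow_eq_sum_gaussBinom (w a b : R) (n : ℕ) :
    ∏ k ∈ Finset.range n, (a + b * w ^ k) =
      ∑ k ∈ Finset.range (n + 1), gaussBinom w n k * w ^ (k.choose 2) * b ^ k * a ^ (n - k) := by
  induction n generalizing b with
  | zero => simp [gaussBinom_zero_right]
  | succ n ih =>
    have h1 : ∏ k ∈ Finset.range n, (a + b * w ^ (k + 1)) =
        ∏ k ∈ Finset.range n, (a + (b * w) * w ^ k) :=
      Finset.prod_congr rfl fun k _ => by ring
    rw [Finset.prod_range_succ', h1, ih, pow_zero, mul_one, mul_add]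
    rw [Finset.sum_range_succ' _ (n + 1)]
    simp only [gaussBinom_succ_succ, add_mul, Finset.sum_add_distrib]
    have h2 : ∀ k ∈ Finset.range (n + 1),
        gaussBinom w n k * w ^ ((k + 1).choose 2) * b ^ (k + 1) * a ^ (n + 1 - (k + 1)) =
        gaussBinom w n k * w ^ (k.choose 2) * (b * w) ^ k * a ^ (n - k) * b := by
      intro k _
      rw [Nat.succ_sub_succ, Nat.choose_succ_succ' k 1, Nat.choose_one_right]
      ring
    rw [Finset.sum_congr rfl h2, ← Finset.sum_mul]
    rw [add_comm, add_assoc]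
    congr 1
    conv_rhs => rw [Finset.sum_range_succ _ n, gaussBinom_eq_zero w (Nat.lt_succ_self n)]
    conv_lhs => rw [Finset.sum_range_succ' _ n, add_mul, Finset.sum_mul]
    congr 1
    · rw [mul_zero, zero_mul, zero_mul, zero_mul, add_zero]
      refine Finset.sum_congr rfl fun k hk => ?_
      rw [Finset.mem_range] at hk
      obtain ⟨m, rfl⟩ := Nat.exists_eq_add_of_lt hk
      rw [show k + m + 1 + 1 - (k + 1) = (k + m + 1 - (k + 1)) + 1 by omega]
      ring
    · simp [gaussBinom_zero_right, pow_succ]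

/-- The finite `q`-Pochhammer symbol `∏ k < n, (1 - w ^ (k + 1))`. -/
def qFactorial (w : R) (n : ℕ) : R := ∏ k ∈ Finset.range n, (1 - w ^ (k + 1))

theorem qFactorial_succ (w : R) (n : ℕ) :
    qFactorial w (n + 1) = qFactorial w n * (1 - w ^ (n + 1)) :=
  Finset.prod_range_succ _ _

/-- The factorial formula for Gaussian binomials, cleared of denominators so that it holds in any
commutative ring; the induction is on i + j by the Pascal rule. -/
theorem qFactorial_mul_qFactorial_mul_gaussBinom (w : R) (i j : ℕ) :
    qFactorial w i * qFactorial w j * gaussBinom w (i + j) i = qFactorial w (i + j) := by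
  induction h : i + j generalizing i j with
  | zero =>
    obtain ⟨rfl, rfl⟩ : i = 0 ∧ j = 0 := by omega
    simp [qFactorial, gaussBinom_zero_right]
  | succ n ih =>
    rcases i with _ | i
    · obtain rfl : j = n + 1 := by omega
      simp [gaussBinom_zero_right, qFactorial]
    rcases j with _ | j
    · obtain rfl : i = n := by omega
      have := ih i 0 rfl
      rw [gaussBinom_succ_succ, gaussBinom_eq_zero w (Nat.lt_succ_self i), qFactorial_succ]
      linear_combination (1 - w ^ (i + 1)) * this
    · obtain rfl : n = i + j + 1 := by omega
      have h1 := ih i (j + 1) rfl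
      have h2 := ih (i + 1) j (by ring)
      rw [gaussBinom_succ_succ, qFactorial_succ w (i + j + 1)]
      rw [qFactorial_succ w i] at h2 ⊢
      rw [qFactorial_succ w j] at h1 ⊢
      linear_combination (1 - w ^ (i + 1)) * h1 + w ^ (i + 1) * (1 - w ^ (j + 1)) * h2

end GaussBinom

theorem X_pow_dvd_qFactorial_sub {a : ℕ} (ha : 0 < a) {m n : ℕ} (h : m ≤ n) :
    (X : ℤ⟦X⟧) ^ (m + 1) ∣ qFactorial (X ^ a) n - qFactorial (X ^ a) m := by
  induction n, h using Nat.le_induction with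
  | base => simp
  | succ n h ih =>
    rw [qFactorial_succ, mul_sub, mul_one, sub_right_comm, ← pow_mul]
    refine dvd_sub ih (Dvd.dvd.mul_left (pow_dvd_pow _ ?_) _)
    nlinarith

theorem isUnit_of_constantCoeff_eq_one {A : ℤ⟦X⟧} (h : constantCoeff A = 1) : IsUnit A := by
  rw [isUnit_iff_constantCoeff, h]; exact isUnit_one

theorem isUnit_qFactorial_X_pow {a : ℕ} (ha : 0 < a) (n : ℕ) :
    IsUnit (qFactorial (X ^ a : ℤ⟦X⟧) n) := by
  apply isUnit_of_constantCoeff_eq_one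
  rw [qFactorial, map_prod]
  exact Finset.prod_eq_one fun k _ => by simp [ha.ne']

/-- Modulo X ^ (m + 1) every factorial of index at least m equals the one of index m, call it P. The
factorial formula becomes P * P * G ≡ P, and P is a unit. -/
theorem X_pow_dvd_gaussBinom_mul_qFactorial_sub_one {a : ℕ} (ha : 0 < a) {i j m n : ℕ}
    (hi : m ≤ i) (hj : m ≤ j) (hn : m ≤ n) :
    (X : ℤ⟦X⟧) ^ (m + 1) ∣ gaussBinom (X ^ a) (i + j) i * qFactorial (X ^ a) n - 1 := by
  obtain ⟨ti, hti⟩ := X_pow_dvd_qFactorial_sub ha hi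
  obtain ⟨tj, htj⟩ := X_pow_dvd_qFactorial_sub ha hj
  obtain ⟨tn, htn⟩ := X_pow_dvd_qFactorial_sub ha hn
  obtain ⟨tk, htk⟩ := X_pow_dvd_qFactorial_sub ha (show m ≤ i + j by omega)
  have h := qFactorial_mul_qFactorial_mul_gaussBinom (X ^ a : ℤ⟦X⟧) i j
  rw [← (isUnit_qFactorial_X_pow ha m).dvd_mul_left]
  rw [eq_add_of_sub_eq hti, eq_add_of_sub_eq htj, eq_add_of_sub_eq htk] at h
  rw [eq_add_of_sub_eq htn]
  generalize gaussBinom (X ^ a : ℤ⟦X⟧) (i + j) i = G at *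
  generalize qFactorial (X ^ a : ℤ⟦X⟧) m = p at *
  generalize (X : ℤ⟦X⟧) ^ (m + 1) = Z at *
  refine ⟨tk - G * ti * p - G * tj * p - Z * ti * tj * G + p * G * tn, ?_⟩
  linear_combination h

theorem finite_triple_product (s : ℤˣ) {b c : ℕ} (hb : 0 < b) (hc : 0 < c) (N : ℕ) :
    (∏ k ∈ Finset.range N, (1 + C (s : ℤ) * X ^ ((b + c) * k + b))) *
      ∏ k ∈ Finset.range N, (1 + C (s : ℤ) * X ^ ((b + c) * k + c)) =
    ∑ j ∈ Finset.range (2 * N + 1), gaussBinom (X ^ (b + c) : ℤ⟦X⟧) (2 * N) j *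
      (C ((s ^ (j - N : ℤ) : ℤˣ) : ℤ) * X ^ (thetaExp b c (j - N)).toNat) := by
  have hss : (C (s : ℤ) : ℤ⟦X⟧) * C (s : ℤ) = 1 := by
    rw [← map_mul, ← Units.val_mul, Int.units_mul_self, Units.val_one, map_one]
  -- The shift a = X ^ ((b + c) * N) centres the product of 2N factors: the first N yield the
  -- c-product in reversed order, the last N the b-product.
  have hq := prod_add_mul_pow_eq_sum_gaussBinom (X ^ (b + c) : ℤ⟦X⟧) (X ^ ((b + c) * N))
    (C (s : ℤ) * X ^ b) (2 * N)
  rw [two_mul, Finset.prod_range_add, ← Finset.prod_range_reflect] at hq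
  have h1 : ∀ k ∈ Finset.range N,
      (X ^ ((b + c) * N) + C (s : ℤ) * X ^ b * (X ^ (b + c)) ^ (N - 1 - k) : ℤ⟦X⟧) =
      (C (s : ℤ) * X ^ ((b + c) * (N - 1 - k) + b)) * (1 + C (s : ℤ) * X ^ ((b + c) * k + c)) := by
    intro k hk
    rw [Finset.mem_range] at hk
    obtain ⟨m, rfl⟩ := Nat.exists_eq_add_of_lt hk
    rw [show k + m + 1 - 1 - k = m by omega]
    linear_combination (-X ^ ((b + c) * (k + m + 1))) * hss
  have h2 : ∀ k ∈ Finset.range N,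
      (X ^ ((b + c) * N) + C (s : ℤ) * X ^ b * (X ^ (b + c)) ^ (N + k) : ℤ⟦X⟧) =
      X ^ ((b + c) * N) * (1 + C (s : ℤ) * X ^ ((b + c) * k + b)) := by
    intro k _
    ring
  rw [Finset.prod_congr rfl h1, Finset.prod_congr rfl h2, Finset.prod_mul_distrib,
    Finset.prod_mul_distrib, Finset.prod_mul_distrib, Finset.prod_const, Finset.prod_const,
    Finset.prod_pow_eq_pow_sum, Finset.card_range] at hq
  have hX : (X : ℤ⟦X⟧) ≠ 0 := X_ne_zero
  have hC : (C (s : ℤ) : ℤ⟦X⟧) ≠ 0 := left_ne_zero_of_mul_eq_one hss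
  -- The monomial extracted from the 2N factors; it is cancelled at the end, so the comparison of
  -- exponents takes place without division.
  have hK : (C (s : ℤ) ^ N * X ^ (∑ k ∈ Finset.range N, ((b + c) * (N - 1 - k) + b)) *
      (X ^ ((b + c) * N)) ^ N : ℤ⟦X⟧) ≠ 0 :=
    mul_ne_zero (mul_ne_zero (pow_ne_zero _ hC) (pow_ne_zero _ hX))
      (pow_ne_zero _ (pow_ne_zero _ hX))
  apply mul_left_cancel₀ hK
  rw [Finset.mul_sum]
  have hS : ∑ k ∈ Finset.range N, ((b + c) * (N - 1 - k) + b) =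
      (b + c) * N.choose 2 + b * N := by
    rw [Finset.sum_add_distrib, ← Finset.mul_sum,
      Finset.sum_range_reflect (fun k => k), Finset.sum_range_id, Nat.choose_two_right]
    simp [mul_comm]
  rw [hS] at hq ⊢
  refine Eq.trans (by ring) (hq.trans ?_)
  rw [← two_mul]
  refine Finset.sum_congr rfl fun j hj => ?_
  rw [Finset.mem_range] at hj
  have hsgn : (C (s : ℤ) : ℤ⟦X⟧) ^ j = C (s : ℤ) ^ N * C ((s ^ (j - N : ℤ) : ℤˣ) : ℤ) := by
    rw [← map_pow, ← map_pow, ← map_mul, ← Units.val_pow_eq_pow_val, ← Units.val_pow_eq_pow_val,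
      ← Units.val_mul, ← zpow_natCast, ← zpow_natCast, ← zpow_add]
    congr 3
    ring_nf
  have hexp : (b + c) * (j.choose 2) + b * j + (b + c) * N * (2 * N - j) =
      (b + c) * N.choose 2 + b * N + (b + c) * N * N + (thetaExp b c (j - N)).toNat := by
    have e0 := two_mul_thetaExp b c (j - N)
    have e1 : 0 ≤ thetaExp b c (j - N) := (abs_nonneg _).trans (abs_le_thetaExp hb hc _)
    have cj : ∀ k : ℕ, (2 : ℤ) * (k.choose 2 : ℕ) = k * (k - 1) := by
      intro k
      induction k with
      | zero => simp
      | succ k ih =>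
        rw [Nat.choose_succ_succ' k 1, Nat.choose_one_right]
        push_cast
        linear_combination ih
    zify [show j ≤ 2 * N by omega]
    rw [Int.toNat_of_nonneg e1]
    apply mul_left_cancel₀ (two_ne_zero (α := ℤ))
    linear_combination ((b : ℤ) + c) * cj j - ((b : ℤ) + c) * cj N - e0
  calc _ = gaussBinom (X ^ (b + c) : ℤ⟦X⟧) (2 * N) j * C (s : ℤ) ^ j *
        X ^ ((b + c) * (j.choose 2) + b * j + (b + c) * N * (2 * N - j)) := by
        rw [mul_pow, ← pow_mul, ← pow_mul, ← pow_mul]; ring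
    _ = _ := by rw [hexp, hsgn, ← pow_mul]; ring

open Filter Topology in
theorem tendsto_prod_theta (s : ℤˣ) {b c : ℕ} (hb : 0 < b) (hc : 0 < c) :
    Tendsto (fun N => ((∏ k ∈ Finset.range N, (1 + C (s : ℤ) * X ^ ((b + c) * k + b))) *
      ∏ k ∈ Finset.range N, (1 + C (s : ℤ) * X ^ ((b + c) * k + c))) *
        qFactorial (X ^ (b + c) : ℤ⟦X⟧) N) atTop (𝓝 (theta s b c)) := by
  rw [WithPiTopology.tendsto_iff_coeff_tendsto]
  intro d
  apply tendsto_nhds_of_eventually_eq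
  filter_upwards [eventually_ge_atTop d] with N hN
  rw [finite_triple_product s hb hc, Finset.sum_mul, map_sum]
  have key : ∀ j ∈ Finset.range (2 * N + 1),
      coeff d (gaussBinom (X ^ (b + c) : ℤ⟦X⟧) (2 * N) j *
        (C ((s ^ (j - N : ℤ) : ℤˣ) : ℤ) * X ^ (thetaExp b c (j - N)).toNat) *
        qFactorial (X ^ (b + c) : ℤ⟦X⟧) N) =
      if thetaExp b c (j - N) = d then ((s ^ (j - N : ℤ) : ℤˣ) : ℤ) else 0 := by
    intro j hj
    rw [Finset.mem_range] at hj
    have habs := abs_le_thetaExp hb hc (j - N)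
    obtain ⟨e, he⟩ := Int.eq_ofNat_of_zero_le ((abs_nonneg _).trans habs)
    rw [he] at habs
    obtain ⟨i, hi⟩ := Nat.exists_eq_add_of_le (show j ≤ 2 * N by omega)
    -- The error in the j-th term is a multiple of X ^ (N - e + 1 + e). Even when the truncated N -
    -- e is 0, this exponent exceeds N, hence d.
    have hle : N - e ≤ j ∧ N - e ≤ i := by
      rw [abs_le] at habs
      omega
    obtain ⟨t, ht⟩ := X_pow_dvd_gaussBinom_mul_qFactorial_sub_one (show 0 < b + c by omega)
      hle.1 hle.2 (Nat.sub_le N e)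
    rw [← hi] at ht
    rw [he]
    have h3 : gaussBinom (X ^ (b + c) : ℤ⟦X⟧) (2 * N) j *
        (C ((s ^ (j - N : ℤ) : ℤˣ) : ℤ) * X ^ (e : ℤ).toNat) * qFactorial (X ^ (b + c) : ℤ⟦X⟧) N =
        C ((s ^ (j - N : ℤ) : ℤˣ) : ℤ) * X ^ e +
        X ^ (N - e + 1 + e) * (t * C ((s ^ (j - N : ℤ) : ℤˣ) : ℤ)) := by
      rw [Int.toNat_natCast]
      linear_combination (C ((s ^ (j - N : ℤ) : ℤˣ) : ℤ) * X ^ e) * ht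
    rw [h3, map_add, coeff_C_mul, coeff_X_pow_mul', if_neg (by omega), add_zero, coeff_X_pow]
    simp [eq_comm]
  rw [Finset.sum_congr rfl key]
  refine HasSum.unique ?_ ((isThetaSum_theta s hb hc).hasSum d)
  have : ∑ j ∈ Finset.range (2 * N + 1),
      (if thetaExp b c (j - N) = d then ((s ^ (j - N : ℤ) : ℤˣ) : ℤ) else 0) =
      ∑ n ∈ Finset.Icc (-N : ℤ) N, if thetaExp b c n = d then ((s ^ n : ℤˣ) : ℤ) else 0 := by
    refine Finset.sum_nbij' (fun j => (j : ℤ) - N) (fun n => (n + N).toNat) ?_ ?_ ?_ ?_ ?_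
    · intro j hj; simp only [Finset.mem_range, Finset.mem_Icc] at *; omega
    · intro j hj; simp only [Finset.mem_range, Finset.mem_Icc] at *; omega
    · intro j hj; simp only [Finset.mem_range] at *; omega
    · intro j hj; simp only [Finset.mem_Icc] at *; omega
    · intro j hj; rfl
  rw [this]
  apply hasSum_sum_of_ne_finset_zero
  intro n hn
  rw [if_neg]
  intro h
  apply hn
  have := abs_le_thetaExp hb hc n
  rw [Finset.mem_Icc, ← abs_le]
  omega

/-! ### Infinite products and the Jacobi triple product -/

/-- The infinite product `∏ n, (1 + s X ^ (a n + b))`. -/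
noncomputable def pochProd (s : ℤ) (a b : ℕ) : ℤ⟦X⟧ :=
  ∏' n : ℕ, (1 + C s * X ^ (a * n + b))

theorem multipliable_one_add_C_mul_X_pow (s : ℕ → ℤ) {f : ℕ → ℕ} (hf : ∀ n, n ≤ f n) :
    Multipliable (fun n : ℕ => (1 + C (s n) * X ^ (f n) : ℤ⟦X⟧)) := by
  apply WithPiTopology.multipliable_one_add_of_tendsto_order_atTop_nhds_top
  refine ENat.tendsto_nhds_top_iff_natCast_lt.mpr
    (fun n => Filter.eventually_atTop.mpr ⟨n + 1, fun m hm => ?_⟩)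
  refine lt_of_lt_of_le ?_ (le_order_mul _ _)
  rw [order_X_pow]
  refine lt_of_lt_of_le ?_ le_add_self
  have := hf m
  exact_mod_cast (by omega : n < f m)

theorem hasProd_pochProd (s : ℤ) {a : ℕ} (ha : 0 < a) (b : ℕ) :
    HasProd (fun n : ℕ => (1 + C s * X ^ (a * n + b) : ℤ⟦X⟧)) (pochProd s a b) :=
  (multipliable_one_add_C_mul_X_pow (fun _ => s) (fun n => by nlinarith)).hasProd

theorem HasProd.constantCoeff_eq_one {ι : Type*} {f : ι → ℤ⟦X⟧} {A : ℤ⟦X⟧} (h : HasProd f A)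
    (hf : ∀ i, constantCoeff (f i) = 1) : constantCoeff A = 1 := by
  have := h.map (constantCoeff (R := ℤ)) (WithPiTopology.continuous_constantCoeff ℤ)
  refine this.unique ?_
  simp only [Function.comp_def, hf]
  exact hasProd_one

theorem isUnit_pochProd (s : ℤ) {a b : ℕ} (ha : 0 < a) (hb : 0 < b) : IsUnit (pochProd s a b) :=
  isUnit_of_constantCoeff_eq_one <| (hasProd_pochProd s ha b).constantCoeff_eq_one fun n => by
    simp [hb.ne']

/-- The Jacobi triple product identity. -/
theorem theta_eq_pochProd (s : ℤˣ) {b c : ℕ} (hb : 0 < b) (hc : 0 < c) :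
    theta s b c = pochProd s (b + c) b * pochProd s (b + c) c * pochProd (-1) (b + c) (b + c) := by
  refine tendsto_nhds_unique (tendsto_prod_theta s hb hc) ?_
  have hbc : 0 < b + c := by omega
  convert ((hasProd_pochProd s hbc b).tendsto_prod_nat.mul
    (hasProd_pochProd s hbc c).tendsto_prod_nat).mul
    (hasProd_pochProd (-1) hbc (b + c)).tendsto_prod_nat using 2 with N
  congr 1
  refine Finset.prod_congr rfl fun k _ => ?_
  rw [map_neg, map_one, ← pow_mul]
  ring

/-- Sorts the factors by the residue of their index modulo k. -/
theorem pochProd_split (s : ℤ) {a : ℕ} (ha : 0 < a) (b k : ℕ) (hk : k ≠ 0) :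
    pochProd s a b = ∏ j ∈ Finset.range k, pochProd s (k * a) (a * j + b) := by
  have : NeZero k := ⟨hk⟩
  have h1 : ∀ j : Fin k, HasProd (fun n : ℕ => (1 + C s * X ^ (k * a * n + (a * j + b)) : ℤ⟦X⟧))
      (pochProd s (k * a) (a * j + b)) := fun j => hasProd_pochProd s (by positivity) _
  have h2 := (Nat.divModEquiv k).symm.hasProd_iff.mpr (hasProd_pochProd s ha b)
  have h3 := (Equiv.prodComm (Fin k) ℕ).hasProd_iff.mpr h2
  have h4 := h3.prod_fiberwise (g := fun j : Fin k => pochProd s (k * a) (a * j + b))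
    (fun j => by
      convert h1 j using 2 with n
      simp only [Function.comp_apply, Equiv.prodComm_apply, Prod.swap_prod_mk,
        Nat.divModEquiv_symm_apply]
      ring)
  rw [Finset.prod_range]
  exact h4.unique (hasProd_fintype _)

/-- Difference of squares, factor by factor. With `pochProd_split` this proves all the product
identities below. -/
theorem pochProd_mul_neg (s : ℤ) {a : ℕ} (ha : 0 < a) (b : ℕ) :
    pochProd s a b * pochProd (-s) a b = pochProd (-s ^ 2) (2 * a) (2 * b) := by
  refine ((hasProd_pochProd s ha b).mul (hasProd_pochProd (-s) ha b)).unique ?_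
  convert hasProd_pochProd (-s ^ 2) (show 0 < 2 * a by omega) (2 * b) using 2 with n
  simp only [map_neg, map_pow]
  ring

theorem expand_theta (k : ℕ) (hk : k ≠ 0) (s : ℤˣ) {b c : ℕ} (hb : 0 < b) (hc : 0 < c) :
    expand k hk (theta s b c) = theta s (k * b) (k * c) := by
  refine ((isThetaSum_theta s hb hc).expand k hk).eq_of_bijective
    (isThetaSum_theta s (b := k * b) (c := k * c) (by positivity) (by positivity)) id
    Function.bijective_id (fun n => ?_) (fun _ => rfl)
  simp only [id, thetaExp]
  push_cast
  ring

theorem isUnit_theta (s : ℤˣ) {b c : ℕ} (hb : 0 < b) (hc : 0 < c) : IsUnit (theta s b c) := by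
  rw [theta_eq_pochProd s hb hc]
  exact ((isUnit_pochProd _ (by omega) hb).mul (isUnit_pochProd _ (by omega) hc)).mul
    (isUnit_pochProd _ (by omega) (by omega))

/-! ### Product identities between theta functions -/

theorem theta_one_mul_theta_neg_one :
    theta 1 1 1 * theta (-1) 1 1 = theta (-1) 2 2 ^ 2 := by
  have h1 := pochProd_split (-1) (a := 2) (by norm_num) 2 2 (by norm_num)
  have h2 := pochProd_mul_neg 1 (a := 2) (by norm_num) 1
  norm_num [Finset.prod_range_succ] at h1 h2
  simp only [theta_eq_pochProd, Nat.one_pos, Nat.two_pos, Units.val_one, Units.val_neg,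
    Nat.reduceAdd]
  rw [h1, ← h2]
  ring

/-- The three products of the triple product run over the classes 1, 2, 0 modulo 3 and together
exhaust all exponents: the pentagonal number theorem. -/
theorem euler_eq_pochProd : theta (-1) 1 2 = pochProd (-1) 1 1 := by
  have h1 := pochProd_split (-1) (a := 1) (by norm_num) 1 3 (by norm_num)
  norm_num [Finset.prod_range_succ] at h1
  rw [theta_eq_pochProd _ Nat.one_pos Nat.two_pos, h1]
  rfl

theorem euler_mul_gauss : theta (-1) 1 2 * theta 1 1 3 = theta (-1) 2 4 ^ 2 := by
  have h1 := pochProd_split (-1) (a := 1) (by norm_num) 1 2 (by norm_num)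
  have h2 := pochProd_split (-1) (a := 2) (by norm_num) 2 2 (by norm_num)
  have h3 := pochProd_split (-1) (a := 2) (by norm_num) 2 3 (by norm_num)
  have h4 := pochProd_split 1 (a := 2) (by norm_num) 1 2 (by norm_num)
  have h5 := pochProd_mul_neg 1 (a := 2) (by norm_num) 1
  norm_num [Finset.prod_range_succ] at h1 h2 h3 h4 h5
  rw [euler_eq_pochProd, theta_eq_pochProd (-1) (b := 2) (c := 4) (by norm_num) (by norm_num),
    theta_eq_pochProd 1 (b := 1) (c := 3) (by norm_num) (by norm_num)]
  simp only [Units.val_one, Units.val_neg, Nat.reduceAdd]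
  rw [← h3, ← h4, h1, h2, ← h5]
  ring

theorem euler_mul_theta_one_five :
    theta (-1) 1 2 * theta (-1) 1 5 = theta (-1) 1 1 * theta 1 3 9 := by
  have h1 := pochProd_split (-1) (a := 1) (by norm_num) 1 2 (by norm_num)
  have h2 := pochProd_split (-1) (a := 2) (by norm_num) 1 3 (by norm_num)
  have h3 := pochProd_split (-1) (a := 6) (by norm_num) 6 2 (by norm_num)
  have h4 := pochProd_split 1 (a := 6) (by norm_num) 3 2 (by norm_num)
  have h5 := pochProd_mul_neg 1 (a := 6) (by norm_num) 3
  norm_num [Finset.prod_range_succ] at h1 h2 h3 h4 h5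
  rw [euler_eq_pochProd, theta_eq_pochProd (-1) (b := 1) (c := 5) (by norm_num) (by norm_num),
    theta_eq_pochProd (-1) (b := 1) (c := 1) (by norm_num) (by norm_num),
    theta_eq_pochProd 1 (b := 3) (c := 9) (by norm_num) (by norm_num)]
  simp only [Units.val_one, Units.val_neg, Nat.reduceAdd]
  rw [← h4, h1, h3, ← h5, h2]
  ring

/-- Euler's theorem that partitions into odd parts and into distinct parts are equinumerous, in X ^
k. -/
theorem pochProd_neg_one_two_mul_pochProd_one (k : ℕ) (hk : 0 < k) :
    pochProd (-1) (2 * k) k * pochProd 1 k k = 1 := by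
  have h1 := pochProd_split (-1) hk k 2 (by norm_num)
  have h2 := pochProd_mul_neg 1 hk k
  norm_num [Finset.prod_range_succ] at h1 h2
  rw [← two_mul] at h1
  apply (isUnit_pochProd (-1) (a := 2 * k) (b := 2 * k) (by omega) (by omega)).mul_left_cancel
  rw [h1] at h2
  linear_combination h2

theorem theta_neg_one_mul_theta_one_two :
    theta (-1) 1 1 * theta 1 1 2 = theta (-1) 1 2 * theta (-1) 3 3 := by
  have h1 := pochProd_split (-1) (a := 1) (by norm_num) 1 2 (by norm_num)
  have h2 := pochProd_split (-1) (a := 3) (by norm_num) 3 2 (by norm_num)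
  have h3 := pochProd_split 1 (a := 1) (by norm_num) 1 3 (by norm_num)
  have h4 := pochProd_neg_one_two_mul_pochProd_one 1 one_pos
  have h5 := pochProd_neg_one_two_mul_pochProd_one 3 three_pos
  norm_num [Finset.prod_range_succ] at h1 h2 h3 h4 h5
  rw [euler_eq_pochProd, theta_eq_pochProd (-1) (b := 1) (c := 1) (by norm_num) (by norm_num),
    theta_eq_pochProd 1 (b := 1) (c := 2) (by norm_num) (by norm_num),
    theta_eq_pochProd (-1) (b := 3) (c := 3) (by norm_num) (by norm_num)]
  simp only [Units.val_one, Units.val_neg, Nat.reduceAdd]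
  apply (isUnit_pochProd 1 (a := 3) (b := 3) (by omega) (by omega)).mul_right_cancel
  rw [h1, h2]
  rw [h3] at h4
  linear_combination (pochProd (-1) 2 1 * pochProd (-1) 2 2 * pochProd (-1) 6 3 *
    pochProd (-1) 6 6) * (h4 - h5)

/-! ### Dissections -/

theorem Int.units_zpow_add_two_mul (s : ℤˣ) (m k : ℤ) : s ^ (m + 2 * k) = s ^ m := by
  rw [zpow_add, zpow_mul, zpow_ofNat, Int.units_sq, one_zpow, mul_one]

theorem theta_three_dissection (s : ℤˣ) :
    theta s 1 1 = theta s 9 9 + C (2 * (s : ℤ)) * (X * theta s 3 15) := by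
  have h1 := isThetaSum_theta s (b := 9) (c := 9) (by norm_num) (by norm_num)
  have h2 := ((isThetaSum_theta s (b := 3) (c := 15) (by norm_num) (by norm_num)).X_pow_mul 1).C_mul
    (s : ℤ)
  have h3 := h1.add (h2.add h2)
  have h4 := isThetaSum_theta s (b := 1) (c := 1) (by norm_num) (by norm_num)
  refine (h4.eq_of_bijective h3
    -- The square n ^ 2 is split by n modulo 3; the classes 1 and 2 are exchanged by n ↦ -n and
    -- contribute equally, whence the factor 2.
    (Sum.elim (fun m => 3 * m) (Sum.elim (fun m => 3 * m - 1) (fun m => 1 - 3 * m)))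
    ⟨?_, ?_⟩ ?_ ?_).trans ?_
  · rintro (x | x | x) (y | y | y) h <;> simp only [Sum.elim_inl, Sum.elim_inr] at h <;>
      (congr; omega)
  · intro n
    obtain h | h | h : n % 3 = 0 ∨ n % 3 = 1 ∨ n % 3 = 2 := by omega
    · exact ⟨.inl (n / 3), by simp only [Sum.elim_inl]; omega⟩
    · exact ⟨.inr (.inr (-(n / 3))), by simp only [Sum.elim_inr]; omega⟩
    · exact ⟨.inr (.inl (n / 3 + 1)), by simp only [Sum.elim_inr, Sum.elim_inl]; omega⟩
  · rintro (x | x | x) <;> simp only [Sum.elim_inl, Sum.elim_inr] <;>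
      apply mul_left_cancel₀ (two_ne_zero (α := ℤ)) <;>
      simp only [mul_add, two_mul_thetaExp] <;> push_cast <;> ring
  · rintro (x | x | x) <;> simp only [Sum.elim_inl, Sum.elim_inr] <;> norm_cast
    · rw [← Int.units_zpow_add_two_mul s x x]; congr 1; ring
    · rw [mul_comm s, ← zpow_add_one, ← Int.units_zpow_add_two_mul s (x + 1) (x - 1)]; congr 1; ring
    · rw [mul_comm s, ← zpow_add_one, ← Int.units_zpow_add_two_mul s (x + 1) (- 2 * x)]
      congr 1; ring
  · rw [map_mul, map_ofNat]; ring

/-- The exponent 3m² - 2m + 3n² is even exactly when m ≡ n mod 2. Setting m = u + v, n = u - v then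
separates the variables. -/
theorem progSection_two_zero_theta_mul :
    progSection 2 0 (theta 1 1 5 * theta (-1) 3 3) = theta (-1) 2 4 ^ 2 := by
  have h1 := (isThetaSum_theta 1 (b := 1) (c := 5) (by norm_num) (by norm_num)).mul
    (isThetaSum_theta (-1) (b := 3) (c := 3) (by norm_num) (by norm_num))
  have h2 := isThetaSum_theta (-1) (b := 2) (c := 4) (by norm_num) (by norm_num)
  have e0 : ∀ m n : ℤ, thetaExp 1 5 m + thetaExp 3 3 n = 3 * m ^ 2 - 2 * m + 3 * n ^ 2 := by
    intro m n
    apply mul_left_cancel₀ (two_ne_zero (α := ℤ))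
    simp only [mul_add, two_mul_thetaExp]; push_cast; ring
  have h3 := h1.progSection (a := 2) (r := 0) (by norm_num)
    (g := fun p : ℤ × ℤ => (p.1 + p.2, p.1 - p.2))
    (e' := fun p => thetaExp 2 4 p.1 + thetaExp 2 4 p.2) ?_ ?_ ?_
  · rw [sq]
    refine h3.eq_of_bijective (h2.mul h2) id Function.bijective_id (fun _ => rfl) ?_
    rintro ⟨u, v⟩
    simp only [id, one_zpow, Units.val_one, one_mul]
    norm_cast
    rw [← zpow_add, ← Int.units_zpow_add_two_mul (-1) (u - v) v]; congr 1; ring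
  · rintro ⟨u, v⟩ ⟨u', v'⟩ h
    simp only [Prod.mk.injEq] at h ⊢
    omega
  · rintro ⟨u, v⟩
    simp only [e0]
    push_cast
    have hu := two_mul_thetaExp 2 4 u
    have hv := two_mul_thetaExp 2 4 v
    push_cast at hu hv
    linear_combination -hu - hv
  · rintro ⟨m, n⟩ d h
    simp only [e0] at h
    have hmn : (m - n) % 2 = 0 := by
      have h' : Even ((m - n) * (m + n)) := ⟨d + m - m ^ 2 - 2 * n ^ 2 + n ^ 2 * 0, by
        push_cast at h; linear_combination h⟩
      rw [Int.even_mul] at h'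
      rcases h' with ⟨k, hk⟩ | ⟨k, hk⟩ <;> omega
    exact ⟨((m + n) / 2, (m - n) / 2), by simp only [Prod.mk.injEq]; omega⟩

theorem gauss_three_dissection : theta 1 1 3 = theta 1 3 6 + X * theta 1 9 27 := by
  have h1 := isThetaSum_theta 1 (b := 3) (c := 6) (by norm_num) (by norm_num)
  have h2 := (isThetaSum_theta 1 (b := 9) (c := 27) (by norm_num) (by norm_num)).X_pow_mul 1
  have h4 := isThetaSum_theta 1 (b := 1) (c := 3) (by norm_num) (by norm_num)
  rw [pow_one] at h2
  refine h4.eq_of_bijective (h1.add h2)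
    -- The exponents of f(q^3, q^6) come from two classes modulo 3 of the index of ψ: even m = 2k
    -- from 3k, odd m = 2k + 1 from -1 - 3k. The remaining class gives qψ(q^9).
    (Sum.elim (fun m => if m % 2 = 0 then 3 * (m / 2) else -1 - 3 * (m / 2)) (fun m => 1 - 3 * m))
    ⟨?_, ?_⟩ ?_ ?_
  · rintro (x | x) (y | y) h <;> simp only [Sum.elim_inl, Sum.elim_inr] at h <;>
      (try split_ifs at h) <;> (congr; omega)
  · intro n
    obtain h | h | h : n % 3 = 0 ∨ n % 3 = 1 ∨ n % 3 = 2 := by omega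
    · exact ⟨.inl (2 * (n / 3)), by simp only [Sum.elim_inl]; split_ifs <;> omega⟩
    · exact ⟨.inr (-(n / 3)), by simp only [Sum.elim_inr]; omega⟩
    · exact ⟨.inl (2 * (-(n / 3) - 1) + 1), by simp only [Sum.elim_inl]; split_ifs <;> omega⟩
  · rintro (x | x) <;> simp only [Sum.elim_inl, Sum.elim_inr] <;>
      apply mul_left_cancel₀ (two_ne_zero (α := ℤ)) <;>
      simp only [mul_add, two_mul_thetaExp] <;> push_cast
    · split_ifs with h
      · obtain ⟨k, rfl⟩ : ∃ k, x = 2 * k := ⟨x / 2, by omega⟩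
        rw [show 2 * k / 2 = k by omega]; ring
      · obtain ⟨k, rfl⟩ : ∃ k, x = 2 * k + 1 := ⟨x / 2, by omega⟩
        rw [show (2 * k + 1) / 2 = k by omega]; ring
    · ring
  · rintro (x | x) <;> simp

theorem theta_one_five_two_dissection :
    theta (-1) 1 5 = theta 1 8 16 - X * theta 1 4 20 := by
  have h1 := isThetaSum_theta 1 (b := 8) (c := 16) (by norm_num) (by norm_num)
  have h2 := ((isThetaSum_theta 1 (b := 4) (c := 20) (by norm_num) (by norm_num)).X_pow_mul 1).neg
  have h4 := isThetaSum_theta (-1) (b := 1) (c := 5) (by norm_num) (by norm_num)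
  rw [pow_one] at h2
  rw [sub_eq_add_neg]
  refine h4.eq_of_bijective (h1.add h2)
    (Sum.elim (fun m => 2 * m) (fun m => 1 - 2 * m)) ⟨?_, ?_⟩ ?_ ?_
  · rintro (x | x) (y | y) h <;> simp only [Sum.elim_inl, Sum.elim_inr] at h <;>
      (congr; omega)
  · intro n
    obtain h | h : n % 2 = 0 ∨ n % 2 = 1 := by omega
    · exact ⟨.inl (n / 2), by simp only [Sum.elim_inl]; omega⟩
    · exact ⟨.inr (-(n / 2)), by simp only [Sum.elim_inr]; omega⟩
  · rintro (x | x) <;> simp only [Sum.elim_inl, Sum.elim_inr] <;>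
      apply mul_left_cancel₀ (two_ne_zero (α := ℤ)) <;>
      simp only [mul_add, two_mul_thetaExp] <;> push_cast <;> ring
  · rintro (x | x) <;> simp only [Sum.elim_inl, Sum.elim_inr, one_zpow]
    · rw [← zero_add (2 * x), Int.units_zpow_add_two_mul]; simp
    · rw [show 1 - 2 * x = 1 + 2 * (-x) by ring, Int.units_zpow_add_two_mul]; simp

/-! ### Congruences between power series -/

theorem natCast_dvd_iff {k : ℕ} {A : ℤ⟦X⟧} : (k : ℤ⟦X⟧) ∣ A ↔ ∀ n, (k : ℤ) ∣ coeff n A := by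
  constructor
  · rintro ⟨Z, rfl⟩ n
    rw [← nsmul_eq_mul, map_nsmul, nsmul_eq_mul]
    exact dvd_mul_right _ _
  · intro h
    choose a h using h
    refine ⟨mk a, ?_⟩
    ext n
    rw [← nsmul_eq_mul, map_nsmul, nsmul_eq_mul, coeff_mk, h]

/-- Over `ZMod p` the p-th power of a series is its Frobenius twist, which fixes the coefficients
and replaces X by X ^ p. -/
theorem natCast_dvd_pow_sub_expand (p : ℕ) [hp : Fact p.Prime] (A : ℤ⟦X⟧) :
    (p : ℤ⟦X⟧) ∣ A ^ p - expand p hp.out.ne_zero A := by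
  have h : map (Int.castRingHom (ZMod p)) (A ^ p - expand p hp.out.ne_zero A) = 0 := by
    rw [map_sub, map_pow, map_expand, sub_eq_zero]
    have := MvPowerSeries.map_frobenius_expand p hp.out.ne_zero
      (f := map (Int.castRingHom (ZMod p)) A)
    rw [ZMod.frobenius_zmod, MvPowerSeries.map_id] at this
    exact this.symm
  rw [natCast_dvd_iff]
  intro n
  rw [← ZMod.intCast_zmod_eq_zero_iff_dvd]
  have h' := congrArg (coeff n) h
  rwa [coeff_map, map_zero] at h'

theorem two_dvd_theta_sub_theta (s s' : ℤˣ) (b c : ℕ) :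
    (2 : ℤ⟦X⟧) ∣ theta s b c - theta s' b c := by
  have := natCast_dvd_iff (k := 2) (A := theta s b c - theta s' b c)
  rw [Nat.cast_ofNat] at this
  rw [this]
  intro n
  rw [theta, theta, map_sub, coeff_mk, coeff_mk, ← Finset.sum_sub_distrib]
  refine Finset.dvd_sum fun i _ => ?_
  split_ifs
  · rcases Int.units_eq_one_or (s ^ i) with h | h <;>
      rcases Int.units_eq_one_or (s' ^ i) with h' | h' <;> simp [h, h']
  · simp

/-- Modulo 2 the 3-dissection says that φ is unchanged by q ↦ q^9, so by induction on the degree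
only the constant term survives. -/
theorem two_dvd_theta_one_one_sub_one (s : ℤˣ) : (2 : ℤ⟦X⟧) ∣ theta s 1 1 - 1 := by
  have key := natCast_dvd_iff (k := 2) (A := theta s 1 1 - 1)
  rw [Nat.cast_ofNat] at key
  rw [key]
  have h := theta_three_dissection s
  rw [show theta s 9 9 = expand 9 (by norm_num) (theta s 1 1) from
    (expand_theta 9 _ s one_pos one_pos).symm] at h
  intro n
  induction n using Nat.strong_induction_on with
  | _ n ih =>
    rcases Nat.eq_zero_or_pos n with rfl | hn
    · simp [theta, thetaExp]
    · rw [map_sub, coeff_one, if_neg hn.ne', sub_zero, h, map_add, coeff_C_mul, coeff_expand]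
      apply dvd_add
      · split_ifs with h9
        · obtain ⟨k, rfl⟩ := h9
          rw [Nat.mul_div_cancel_left _ (by norm_num)]
          have := ih k (by omega)
          rwa [map_sub, coeff_one, if_neg (by omega), sub_zero] at this
        · exact dvd_zero _
      · exact Dvd.dvd.mul_right (Dvd.intro _ rfl) _

/-! ### The generating function as a product and as a theta quotient -/

/-- The generating function of `t`-Schur overpartitions. -/
noncomputable def schurSeries (t : ℕ) : ℤ⟦X⟧ := mk fun n => (numSchurOverpartitions t n : ℤ)

/-- Each distinct part may be overlined or not, giving a factor 2; a factor 0 removes the partitions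
with a forbidden part. The multiplicative form is what `Nat.Partition.genFun` requires. -/
theorem card_schurOverpartitions (t n : ℕ) :
    ((schurOverpartitions t n).card : ℤ) = ∑ μ : n.Partition,
      μ.parts.toFinsupp.prod fun i _ => if i % (2 * t) ∈ schurResidues t then 2 else 0 := by
  rw [schurOverpartitions, Finset.card_sigma, schurPartitions, Finset.sum_filter]
  push_cast
  refine Finset.sum_congr rfl fun μ _ => ?_
  rw [Finsupp.prod, Multiset.toFinsupp_support]
  split_ifs with h
  · rw [Finset.prod_congr rfl (g := fun _ => 2) fun i hi => if_pos (h i (Multiset.mem_toFinset.mp hi))]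
    simp
  · push Not at h
    obtain ⟨a, ha, ha'⟩ := h
    rw [Finset.prod_eq_zero (Multiset.mem_toFinset.mpr ha) (if_neg ha')]

theorem coeff_schurSeries_pow (t r n : ℕ) :
    coeff n (schurSeries t ^ r) = numSchurOverpartitionTuples t r n := by
  have h := coeff_prod (fun _ : Fin r => schurSeries t) n Finset.univ
  rw [Finset.prod_const, Finset.card_univ, Fintype.card_fin] at h
  rw [h, numSchurOverpartitionTuples, schurOverpartitionTuples, Finset.card_sigma]
  push_cast
  refine Finset.sum_nbij' (fun k => (k : Fin r → ℕ)) (fun k => Finsupp.equivFunOnFinite.symm k)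
    ?_ ?_ ?_ ?_ ?_
  · intro k hk
    rw [Finset.Nat.mem_antidiagonalTuple]
    exact (Finset.mem_finsuppAntidiag.mp hk).1
  · intro k hk
    rw [Finset.Nat.mem_antidiagonalTuple] at hk
    rw [Finset.mem_finsuppAntidiag]
    exact ⟨by simpa using hk, Finset.subset_univ _⟩
  · intro k _
    ext; rfl
  · intro k _
    rfl
  · intro k _
    rw [Fintype.card_piFinset]
    push_cast
    refine Finset.prod_congr rfl fun j _ => ?_
    rw [schurSeries, coeff_mk, numSchurOverpartitions]

theorem schurSeries_eq_genFun (t : ℕ) :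
    schurSeries t =
      Nat.Partition.genFun fun i _ => if i % (2 * t) ∈ schurResidues t then (2 : ℤ) else 0 := by
  ext n
  rw [schurSeries, coeff_mk, numSchurOverpartitions, card_schurOverpartitions,
    Nat.Partition.coeff_genFun]

/-- The local factor of a part size k: for u = 1 it is (1 + X ^ k) / (1 - X ^ k), for u = 0 it is 1.
-/
theorem tsum_X_pow_mul_one_sub {k : ℕ} (hk : 0 < k) (u : ℤ) :
    (1 + ∑' j : ℕ, C (2 * u) * (X : ℤ⟦X⟧) ^ (k * (j + 1))) * (1 - X ^ k) =
      1 + C (2 * u - 1) * X ^ k := by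
  have h0 : constantCoeff (X ^ k : ℤ⟦X⟧) = 0 := by simp [hk.ne']
  have h := WithPiTopology.tsum_pow_mul_one_sub_of_constantCoeff_eq_zero h0
  have hs := WithPiTopology.summable_pow_of_constantCoeff_eq_zero h0
  have : ∑' j : ℕ, C (2 * u) * (X : ℤ⟦X⟧) ^ (k * (j + 1)) =
      C (2 * u) * X ^ k * ∑' j : ℕ, (X ^ k : ℤ⟦X⟧) ^ j := by
    rw [← hs.tsum_mul_left]
    refine tsum_congr fun j => ?_
    ring
  rw [this, add_mul, mul_assoc, h, map_sub, map_one]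
  ring

theorem hasProd_ite_pochProd (s : ℤ) {a b : ℕ} (ha : 0 < a) (hb : 0 < b) (hba : b ≤ a)
    (v : ℕ → ℤ) (hv : ∀ i, v i = if (i + 1) % a = b % a then 1 else 0) :
    HasProd (fun i : ℕ => (1 + C (s * v i) * X ^ (i + 1) : ℤ⟦X⟧)) (pochProd s a b) := by
  have hg : Function.Injective (fun n : ℕ => a * n + b - 1) := by
    intro m n h
    simp only at h
    exact Nat.eq_of_mul_eq_mul_left ha (by omega)
  rw [← hg.hasProd_iff]
  · convert hasProd_pochProd s ha b using 2 with n
    rw [Function.comp_apply, Nat.sub_add_cancel (by omega), hv, if_pos, mul_one]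
    rw [Nat.sub_add_cancel (by omega)]
    simp
  · intro i hi
    rw [hv, if_neg]
    · simp
    · intro h
      apply hi
      have hle : b ≤ i + 1 := by
        by_contra! hlt
        rw [Nat.mod_eq_of_lt (by omega)] at h
        rcases hba.lt_or_eq with h' | rfl
        · rw [Nat.mod_eq_of_lt h'] at h; omega
        · rw [Nat.mod_self] at h; omega
      obtain ⟨k, hk⟩ := (Nat.modEq_iff_dvd' hle).mp h.symm
      exact ⟨k, by simp only; omega⟩

theorem schurSeries_nine_mul_pochProd :
    schurSeries 9 * pochProd (-1) 2 1 * pochProd 1 18 9 = pochProd 1 2 1 * pochProd (-1) 18 9 := by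
  set u : ℕ → ℤ := fun i => if (i + 1) % (2 * 9) ∈ schurResidues 9 then 1 else 0 with hu
  set v : ℕ → ℤ := fun i => if (i + 1) % 2 = 1 % 2 then 1 else 0 with hv
  set t : ℕ → ℤ := fun i => if (i + 1) % 18 = 9 % 18 then 1 else 0 with ht
  -- The allowed part sizes (`u`) and the odd multiples of 9 (`t`) partition the odd numbers (`v`).
  have huv : ∀ i, u i + t i = v i ∧ u i * t i = 0 := by
    intro i
    simp only [hu, hv, ht, schurResidues, Finset.mem_filter, Finset.mem_range]
    have h1 : Odd ((i + 1) % 18) ↔ (i + 1) % 2 = 1 := by rw [Nat.odd_iff]; omega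
    simp only [h1]
    split_ifs <;> first | (constructor <;> rfl) | (exfalso; omega)
  have hpos : ∀ n : ℕ, n ≤ n + 1 := fun n => Nat.le_succ n
  have hF := Nat.Partition.hasProd_genFun
    (fun i _ => if i % (2 * 9) ∈ schurResidues 9 then (2 : ℤ) else 0)
  rw [← schurSeries_eq_genFun] at hF
  have hM := (multipliable_one_add_C_mul_X_pow (fun i => (-1) * u i) hpos).hasProd
  have hP := (multipliable_one_add_C_mul_X_pow (fun i => 1 * u i) hpos).hasProd
  have hv1 : ∀ s, HasProd (fun i : ℕ => (1 + C (s * v i) * X ^ (i + 1) : ℤ⟦X⟧)) (pochProd s 2 1) :=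
    fun s => hasProd_ite_pochProd s (by norm_num) (by norm_num) (by norm_num) v fun i => rfl
  have ht1 : ∀ s, HasProd (fun i : ℕ => (1 + C (s * t i) * X ^ (i + 1) : ℤ⟦X⟧))
      (pochProd s 18 9) :=
    fun s => hasProd_ite_pochProd s (by norm_num) (by norm_num) (by norm_num) t fun i => rfl
  have hsplit : ∀ s, ∀ A : ℤ⟦X⟧, HasProd (fun i : ℕ => (1 + C (s * u i) * X ^ (i + 1) : ℤ⟦X⟧)) A →
      A * pochProd s 18 9 = pochProd s 2 1 := by
    intro s A hA
    refine (hA.mul (ht1 s)).unique ?_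
    convert hv1 s using 2 with i
    obtain ⟨h1, h2⟩ := huv i
    have h2' : (C (s * u i) : ℤ⟦X⟧) * C (s * t i) = 0 := by
      rw [← map_mul, mul_mul_mul_comm, h2, mul_zero, map_zero]
    have h1' : (C (s * v i) : ℤ⟦X⟧) = C (s * u i) + C (s * t i) := by
      rw [← map_add, ← h1, mul_add]
    linear_combination (X ^ (i + 1)) ^ 2 * h2' - X ^ (i + 1) * h1'
  have h1 := hsplit _ _ hM
  have h2 := hsplit _ _ hP
  have hui : ∀ i, (if (i + 1) % (2 * 9) ∈ schurResidues 9 then (2 : ℤ) else 0) = 2 * u i := by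
    intro i
    simp only [hu]; split_ifs <;> rfl
  have key : ∀ i : ℕ, (1 + ∑' j : ℕ, C (2 * u i) * (X : ℤ⟦X⟧) ^ ((i + 1) * (j + 1))) *
      (1 + C (-1 * u i) * X ^ (i + 1)) = 1 + C (1 * u i) * X ^ (i + 1) := by
    intro i
    have hs := tsum_X_pow_mul_one_sub (Nat.succ_pos i) (u i)
    rcases (by simp only [hu]; split_ifs <;> simp : u i = 0 ∨ u i = 1) with h | h
    · simp [h]
    · rw [h] at hs ⊢
      norm_num at hs ⊢
      rw [sub_eq_add_neg] at hs
      exact hs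
  have hFM := hF.mul hM
  simp only [hui, smul_eq_C_mul, key] at hFM
  have h3 := hFM.unique hP
  rw [← h1, ← h2, ← h3]
  ring

theorem schurSeries_nine_mul_theta :
    schurSeries 9 * theta 1 9 9 * theta (-1) 2 2 = theta 1 1 1 * theta (-1) 18 18 := by
  have h0 := schurSeries_nine_mul_pochProd
  have h1 := pochProd_split (-1) (a := 2) (by norm_num) 2 2 (by norm_num)
  have h2 := pochProd_mul_neg 1 (a := 2) (by norm_num) 1
  have h3 := pochProd_split (-1) (a := 18) (by norm_num) 18 2 (by norm_num)
  have h4 := pochProd_mul_neg 1 (a := 18) (by norm_num) 9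
  norm_num [Finset.prod_range_succ] at h1 h2 h3 h4
  rw [theta_eq_pochProd 1 (b := 9) (c := 9) (by norm_num) (by norm_num),
    theta_eq_pochProd (-1) (b := 2) (c := 2) (by norm_num) (by norm_num),
    theta_eq_pochProd 1 (b := 1) (c := 1) (by norm_num) (by norm_num),
    theta_eq_pochProd (-1) (b := 18) (c := 18) (by norm_num) (by norm_num)]
  simp only [Units.val_one, Units.val_neg, Nat.reduceAdd]
  rw [h1, h3, ← h2, ← h4]
  linear_combination (pochProd 1 18 9 ^ 2 * pochProd (-1) 18 9 * pochProd (-1) 36 36 *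
    pochProd 1 2 1 ^ 2 * pochProd (-1) 2 1 * pochProd (-1) 4 4) * h0

/-! ### Sections of the generating function and their congruences -/

theorem progSection_natCast_mul (a r k : ℕ) (A : ℤ⟦X⟧) :
    progSection a r ((k : ℤ⟦X⟧) * A) = k * progSection a r A := by
  rw [← nsmul_eq_mul, map_nsmul, nsmul_eq_mul]

theorem progSection_one_of_pos {a r : ℕ} (hr : r < a) (hr0 : 0 < r) :
    progSection a r (1 : ℤ⟦X⟧) = 0 := by
  rw [← map_one (expand a (by omega)), progSection_expand_of_pos _ hr hr0]

/-- Apply the 3-dissection to φ(q) and to φ(-q^2), then divide by φ(q^9)φ(-q^18), whose factors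
cancel against the remaining theta functions. -/
theorem schurSeries_nine_identity : ∃ U V : ℤ⟦X⟧, U * theta 1 3 3 = theta 1 1 5 ∧
    V * theta (-1) 3 3 = theta (-1) 1 5 ∧
    schurSeries 9 * (1 - 2 * X ^ 2 * expand 6 (by norm_num) V) =
      1 + 2 * X * expand 3 (by norm_num) U := by
  obtain ⟨A', hA⟩ := (isUnit_theta 1 (b := 3) (c := 3) (by norm_num) (by norm_num)).exists_left_inv
  obtain ⟨B', hB⟩ :=
    (isUnit_theta (-1) (b := 3) (c := 3) (by norm_num) (by norm_num)).exists_left_inv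
  refine ⟨theta 1 1 5 * A', theta (-1) 1 5 * B', by rw [mul_assoc, hA, mul_one],
    by rw [mul_assoc, hB, mul_one], ?_⟩
  have hF := schurSeries_nine_mul_theta
  have h1 := theta_three_dissection 1
  have h2 := congrArg (expand 2 two_ne_zero) (theta_three_dissection (-1))
  simp only [map_add, map_mul, expand_C, expand_X] at h2
  rw [expand_theta _ _ _ (by norm_num) (by norm_num), expand_theta _ _ _ (by norm_num) (by norm_num),
    expand_theta _ _ _ (by norm_num) (by norm_num)] at h2
  have h3 := congrArg (expand 3 three_ne_zero) hA
  have h4 := congrArg (expand 6 (by norm_num)) hB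
  rw [map_mul, map_one, expand_theta _ _ _ (by norm_num) (by norm_num)] at h3 h4
  rw [map_mul, map_mul, expand_theta _ _ _ (by norm_num) (by norm_num),
    expand_theta _ _ _ (by norm_num) (by norm_num)]
  norm_num at h1 h2 h3 h4 ⊢
  rw [h1, h2] at hF
  have hu : IsUnit (theta 1 9 9 * theta (-1) 18 18) :=
    (isUnit_theta _ (by norm_num) (by norm_num)).mul (isUnit_theta _ (by norm_num) (by norm_num))
  apply hu.mul_left_cancel
  linear_combination hF + (-2 * schurSeries 9 * theta 1 9 9 * X ^ 2 * theta (-1) 6 30) * h4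
    - (2 * theta (-1) 18 18 * X * theta 1 3 15) * h3

theorem exists_progSection_schurSeries_nine : ∃ V W : ℤ⟦X⟧,
    V * theta (-1) 3 3 = theta (-1) 1 5 ∧ W * theta (-1) 3 3 ^ 2 = theta (-1) 2 4 ^ 2 ∧
    progSection 6 3 (schurSeries 9) * (1 - 8 * X * V ^ 3) = 4 * W * V ∧
    progSection 6 5 (schurSeries 9) * (1 - 8 * X * V ^ 3) = 8 * W * V ^ 2 ∧
    progSection 6 1 (schurSeries 9) * (1 - 8 * X * V ^ 3) = 2 * W := by
  obtain ⟨U, V, hU, hV, hF⟩ := schurSeries_nine_identity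
  have hW : progSection 2 0 U * theta (-1) 3 3 ^ 2 = theta (-1) 2 4 ^ 2 := by
    have h1 := congrArg (expand 3 three_ne_zero) theta_one_mul_theta_neg_one
    rw [map_mul, map_pow, expand_theta _ _ _ (by norm_num) (by norm_num),
      expand_theta _ _ _ (by norm_num) (by norm_num),
      expand_theta _ _ _ (by norm_num) (by norm_num)] at h1
    norm_num at h1
    have h2 := expand_theta 2 two_ne_zero (-1) (b := 3) (c := 3) (by norm_num) (by norm_num)
    norm_num at h2
    rw [← progSection_mul_expand two_ne_zero two_pos, map_pow, h2, ← progSection_two_zero_theta_mul,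
      ← hU, ← h1]
    congr 1; ring
  refine ⟨V, progSection 2 0 U, hV, hW, ?_⟩
  generalize schurSeries 9 = F at hF ⊢
  set V' := expand 2 two_ne_zero V with hV'
  have h6 : expand 6 (by norm_num) V = expand 3 three_ne_zero V' :=
    expand_mul 3 three_ne_zero 2 two_ne_zero V
  rw [h6] at hF
  -- With y = 2X²V(X^6), multiply F(1 - y) by 1 + y + y². The factor 1 - y³ is a series in X^6, so
  -- it passes through both the 3-section and the 2-section, and the right side is sorted by
  -- residues modulo 3.
  have hF' : F = expand 3 three_ne_zero (1 + 4 * X * U * V') +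
      X * expand 3 three_ne_zero (2 * U + 4 * X * V' ^ 2) +
      X * (X * expand 3 three_ne_zero (2 * V' + 8 * X * U * V' ^ 2)) +
      F * expand 3 three_ne_zero (8 * X ^ 2 * V' ^ 3) := by
    simp only [map_add, map_mul, map_pow, map_one, map_ofNat, expand_X]
    linear_combination (1 + 2 * X ^ 2 * expand 3 three_ne_zero V' +
      4 * X ^ 4 * expand 3 three_ne_zero V' ^ 2) * hF
  have hz1 : ∀ A : ℤ⟦X⟧, progSection 3 1 (expand 3 three_ne_zero A) = 0 :=
    fun A => progSection_expand_of_pos _ (by norm_num) (by norm_num) A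
  have hz2 : ∀ A : ℤ⟦X⟧, progSection 3 2 (expand 3 three_ne_zero A) = 0 :=
    fun A => progSection_expand_of_pos _ (by norm_num) (by norm_num) A
  have hx0 := fun A : ℤ⟦X⟧ => progSection_X_mul_zero (a := 3) (by norm_num) A
  have hx1 := progSection_X_mul 3 0
  have hx2 := progSection_X_mul 3 1
  have hx0' := fun A : ℤ⟦X⟧ => progSection_X_mul_zero (a := 2) (by norm_num) A
  have hx1' := progSection_X_mul 2 0
  norm_num at hx0 hx1 hx2 hx0' hx1'
  have hz' : ∀ A : ℤ⟦X⟧, progSection 2 1 (expand 2 two_ne_zero A) = 0 :=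
    fun A => progSection_expand_of_pos _ (by norm_num) (by norm_num) A
  have hn2 := fun r A => progSection_natCast_mul 2 r 2 A
  have hn4 := fun r A => progSection_natCast_mul 2 r 4 A
  have hn8 := fun r A => progSection_natCast_mul 2 r 8 A
  simp only [Nat.cast_ofNat] at hn2 hn4 hn8
  have g0 := congrArg (progSection 3 0) hF'
  have g1 := congrArg (progSection 3 1) hF'
  have g2 := congrArg (progSection 3 2) hF'
  simp only [LinearMap.map_add, progSection_expand, hx0, hx1, hx2, hz1, hz2, mul_zero, add_zero,
    zero_add, progSection_mul_expand three_ne_zero (r := 0) (by norm_num),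
    progSection_mul_expand three_ne_zero (r := 1) (by norm_num),
    progSection_mul_expand three_ne_zero (r := 2) (by norm_num)] at g0 g1 g2
  have hE : (8 * X ^ 2 * V' ^ 3 : ℤ⟦X⟧) = expand 2 two_ne_zero (8 * X * V ^ 3) := by
    simp only [map_mul, map_pow, map_ofNat, expand_X, hV']
  rw [hE] at g0 g1 g2
  have k0 := congrArg (progSection 2 1) g0
  have k1 := congrArg (progSection 2 0) g1
  have k2 := congrArg (progSection 2 1) g2
  rw [show 4 * X * U * V' = 4 * (X * (U * V')) by ring] at k0
  rw [show 2 * U + 4 * X * V' ^ 2 = 2 * U + 4 * (X * V' ^ 2) by ring] at k1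
  rw [show 2 * V' + 8 * X * U * V' ^ 2 = 2 * V' + 8 * (X * (U * V' ^ 2)) by ring] at k2
  rw [hV', ← map_pow] at k1 k2
  rw [hV'] at k0
  simp only [LinearMap.map_add, hn2, hn4, hn8, hx0', hx1', hz', mul_zero, add_zero,
    zero_add, progSection_one_of_pos one_lt_two one_pos,
    progSection_mul_expand two_ne_zero two_pos, progSection_mul_expand two_ne_zero one_lt_two,
    progSection_comp] at k0 k1 k2
  norm_num at k0 k1 k2
  refine ⟨?_, ?_, ?_⟩
  · linear_combination k0
  · linear_combination k2
  · linear_combination k1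

/-- Modulo 3, 1 - 8qV³ ≡ 1 - 2qV(q^3) = φ(-q)/φ(-q^9) and φ(-q^3)³ ≡ φ(-q^9). The relation for the
section becomes A φ(-q) ≡ E(q^2)² f(-q,-q^5) = φ(-q)ψ(q)ψ(q^3), and φ(-q) is a unit. -/
theorem progSection_six_three_modEq_three :
    (3 : ℤ⟦X⟧) ∣ progSection 6 3 (schurSeries 9) - theta 1 1 3 * theta 1 3 9 := by
  obtain ⟨V, W, hV, hW, hA, -, -⟩ := exists_progSection_schurSeries_nine
  generalize progSection 6 3 (schurSeries 9) = A at *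
  have : Fact (Nat.Prime 3) := ⟨Nat.prime_three⟩
  obtain ⟨Z, hZ⟩ := natCast_dvd_pow_sub_expand 3 V
  obtain ⟨Y, hY⟩ := natCast_dvd_pow_sub_expand 3 (theta (-1) 3 3)
  have h1 := theta_three_dissection (-1)
  have h2 := congrArg (expand 3 three_ne_zero) hV
  rw [map_mul, expand_theta _ _ _ (by norm_num) (by norm_num),
    expand_theta _ _ _ (by norm_num) (by norm_num)] at h2
  rw [expand_theta _ _ _ (by norm_num) (by norm_num)] at hY
  have h3 := euler_mul_theta_one_five
  have h4 := euler_mul_gauss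
  norm_num at h1 h2 hZ hY
  rw [← (isUnit_theta (-1) one_pos one_pos).dvd_mul_left]
  have h5 : theta (-1) 2 4 ^ 2 * theta (-1) 1 5 =
      theta (-1) 1 1 * theta 1 3 9 * theta 1 1 3 := by
    rw [← h4, ← h3]; ring
  refine ⟨A * X * (2 * theta (-1) 9 9 * V ^ 3 + 2 * Z * theta (-1) 9 9) +
    W * V * theta (-1) 9 9 - W * V * Y, ?_⟩
  rw [sub_eq_iff_eq_add] at hZ hY
  linear_combination A * h1 + 2 * A * X * h2 + theta (-1) 9 9 * hA + h5 -
    W * V * hY + 2 * A * X * theta (-1) 9 9 * hZ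
    + (theta (-1) 2 4 ^ 2) * hV + V * theta (-1) 3 3 * hW

theorem progSection_six_one_modEq_eight :
    (8 : ℤ⟦X⟧) ∣ progSection 6 1 (schurSeries 9) - 2 * (theta (-1) 1 2 * theta 1 1 3) := by
  obtain ⟨V, W, hV, hW, -, -, hC⟩ := exists_progSection_schurSeries_nine
  generalize progSection 6 1 (schurSeries 9) = C at *
  obtain ⟨T, hT⟩ := map_dvd (expand 3 three_ne_zero) (two_dvd_theta_one_one_sub_one (-1))
  simp only [map_sub, map_ofNat, map_one] at hT
  rw [expand_theta _ _ _ (by norm_num) (by norm_num), sub_eq_iff_eq_add] at hT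
  norm_num at hT
  rw [hT] at hW
  rw [euler_mul_gauss, ← hW]
  exact ⟨C * X * V ^ 3 - (T + T ^ 2) * W, by linear_combination hC⟩

/-- Modulo 16 the 6n+3 section is 4φ(-q)ψ(q) · ψ(q^3)φ(-q^3). The second factor is a series in q^3,
so only φ(-q)ψ(q) needs a 3-dissection; what results is 4E(q)ψ(q)φ(-q^3)², with φ(-q^3)² ≡ 1 mod 4.
-/
theorem progSection_eighteen_three_modEq_sixteen :
    (16 : ℤ⟦X⟧) ∣ progSection 18 3 (schurSeries 9) - 4 * (theta (-1) 1 2 * theta 1 1 3) := by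
  obtain ⟨V, W, hV, hW, hA, -, -⟩ := exists_progSection_schurSeries_nine
  rw [show progSection 18 3 (schurSeries 9) = progSection 3 0 (progSection 6 3 (schurSeries 9)) by
    rw [progSection_comp]]
  generalize progSection 6 3 (schurSeries 9) = A at *
  obtain ⟨T, hT⟩ := two_dvd_theta_one_one_sub_one (-1)
  have hT' := congrArg (expand 3 three_ne_zero) hT
  simp only [map_sub, map_mul, map_ofNat, map_one] at hT'
  rw [expand_theta _ _ _ (by norm_num) (by norm_num), sub_eq_iff_eq_add] at hT'
  norm_num at hT'
  set T' := expand 3 three_ne_zero T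
  have h3 := euler_mul_theta_one_five
  have h4 := euler_mul_gauss
  have h5 : theta (-1) 2 4 ^ 2 * theta (-1) 1 5 =
      theta (-1) 1 1 * theta 1 3 9 * theta 1 1 3 := by
    rw [← h4, ← h3]; ring
  have h6 : (theta (-1) 1 1 * theta 1 1 3) * (theta 1 3 9 * theta (-1) 3 3) =
      W * V * theta (-1) 3 3 ^ 4 := by
    linear_combination -theta (-1) 3 3 * h5 - theta (-1) 3 3 * theta (-1) 1 5 * hW -
      W * theta (-1) 3 3 ^ 3 * hV
  have h7 : ∃ Z, A = 4 * ((theta (-1) 1 1 * theta 1 1 3) * (theta 1 3 9 * theta (-1) 3 3)) +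
      16 * Z := by
    rw [h6, hT']
    -- 1 + 8XV³ inverts 1 - 8XV³ modulo 64, and φ(-q^3)^4 = (1 + 4(T' + T'²))².
    exact ⟨2 * X * V ^ 3 * (W * V + 2 * X * V ^ 3 * A)
      - W * V * (2 * (T' + T' ^ 2) + 4 * (T' + T' ^ 2) ^ 2),
      by linear_combination (1 + 8 * X * V ^ 3) * hA⟩
  obtain ⟨Z, rfl⟩ := h7
  have e1 := expand_theta 3 three_ne_zero 1 (b := 1) (c := 3) (by norm_num) (by norm_num)
  have e2 := expand_theta 3 three_ne_zero (-1) (b := 1) (c := 1) (by norm_num) (by norm_num)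
  have e3 := expand_theta 3 three_ne_zero (-1) (b := 3) (c := 3) (by norm_num) (by norm_num)
  have e4 := expand_theta 3 three_ne_zero (-1) (b := 1) (c := 5) (by norm_num) (by norm_num)
  have e5 := expand_theta 3 three_ne_zero 1 (b := 1) (c := 2) (by norm_num) (by norm_num)
  have e6 := expand_theta 3 three_ne_zero 1 (b := 3) (c := 9) (by norm_num) (by norm_num)
  norm_num at e1 e2 e3 e4 e5 e6
  have h8 : progSection 3 0 (theta (-1) 1 1 * theta 1 1 3) = theta (-1) 3 3 * theta 1 1 2 := by
    have d1 := theta_three_dissection (-1)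
    norm_num at d1
    rw [d1, gauss_three_dissection, ← e3, ← e4, ← e5, ← e6]
    have : ∀ a b c d : ℤ⟦X⟧, (expand 3 three_ne_zero a + -(2 * (X * expand 3 three_ne_zero b))) *
        (expand 3 three_ne_zero c + X * expand 3 three_ne_zero d) =
        expand 3 three_ne_zero (a * c) + X * expand 3 three_ne_zero (a * d) -
        X * expand 3 three_ne_zero (2 * b * c) -
        X * (X * expand 3 three_ne_zero (2 * b * d)) := by
      intro a b c d
      simp only [map_mul, map_ofNat]
      ring
    rw [this]
    simp only [map_sub, LinearMap.map_add, progSection_expand,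
      progSection_X_mul_zero (a := 3) (by norm_num), Nat.reduceSub]
    have hx2 := progSection_X_mul 3 1
    norm_num at hx2
    rw [hx2]
    simp only [progSection_expand_of_pos three_ne_zero (r := 2) (by norm_num) (by norm_num),
      progSection_expand_of_pos three_ne_zero (r := 1) (by norm_num) (by norm_num)]
    ring
  have hn4 := fun A => progSection_natCast_mul 3 0 4 A
  have hn16 := fun A => progSection_natCast_mul 3 0 16 A
  simp only [Nat.cast_ofNat] at hn4 hn16
  rw [LinearMap.map_add, hn4, hn16, ← e1, ← e2, ← map_mul,
    progSection_mul_expand three_ne_zero three_pos, h8]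
  have h9 := theta_neg_one_mul_theta_one_two
  have h10 : theta (-1) 3 3 * theta 1 1 2 * (theta 1 1 3 * theta (-1) 1 1) =
      theta (-1) 1 2 * theta 1 1 3 * theta (-1) 3 3 ^ 2 := by
    linear_combination theta (-1) 3 3 * theta 1 1 3 * h9
  rw [h10, hT']
  exact ⟨progSection 3 0 Z + (theta (-1) 1 2 * theta 1 1 3) * (T' + T' ^ 2), by ring⟩

theorem progSection_six_five_modEq_thirtyTwo :
    (32 : ℤ⟦X⟧) ∣ progSection 6 5 (schurSeries 9) - 8 * (theta (-1) 2 4 * theta (-1) 1 5) ^ 2 := by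
  obtain ⟨V, W, hV, hW, -, hB, -⟩ := exists_progSection_schurSeries_nine
  generalize progSection 6 5 (schurSeries 9) = B at *
  obtain ⟨T, hT⟩ := map_dvd (expand 3 three_ne_zero) (two_dvd_theta_one_one_sub_one (-1))
  simp only [map_sub, map_ofNat, map_one] at hT
  rw [expand_theta _ _ _ (by norm_num) (by norm_num), sub_eq_iff_eq_add] at hT
  norm_num at hT
  have h : (theta (-1) 2 4 * theta (-1) 1 5) ^ 2 = W * V ^ 2 * (1 + 4 * (T + T ^ 2)) ^ 2 := by
    rw [mul_pow, ← hW, ← hV, hT]; ring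
  rw [h]
  exact ⟨2 * X * V ^ 3 * (W * V ^ 2 + X * V ^ 3 * B)
    - W * V ^ 2 * (2 * (T + T ^ 2) + 4 * (T + T ^ 2) ^ 2),
    by linear_combination (1 + 8 * X * V ^ 3) * hB⟩

theorem progSection_six_five_modEq_sixteen :
    (16 : ℤ⟦X⟧) ∣ progSection 6 5 (schurSeries 9) -
      8 * expand 2 two_ne_zero (theta (-1) 2 4 * theta (-1) 1 5) := by
  obtain ⟨Z, hZ⟩ := progSection_six_five_modEq_thirtyTwo
  have : Fact (Nat.Prime 2) := ⟨Nat.prime_two⟩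
  obtain ⟨Y, hY⟩ := natCast_dvd_pow_sub_expand 2 (theta (-1) 2 4 * theta (-1) 1 5)
  rw [Nat.cast_ofNat] at hY
  exact ⟨2 * Z + Y, by linear_combination hZ + 8 * hY⟩

/-- The odd part of the square is twice a cross term, so the coefficient 8 becomes 16 and only
parity matters from there on: signs drop out, E(q)² ≡ E(q^2), and φ(-q) ≡ 1 reduces E(q) f(-q,-q^5)
= φ(-q)ψ(q^3) to ψ(q^3). -/
theorem progSection_twentyFour_eleven_modEq_thirtyTwo :
    (32 : ℤ⟦X⟧) ∣ progSection 24 11 (schurSeries 9) - 16 * (theta 1 2 4 * theta 1 3 9) := by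
  obtain ⟨Z, hZ⟩ := progSection_six_five_modEq_thirtyTwo
  rw [show progSection 24 11 (schurSeries 9) =
    progSection 2 0 (progSection 2 1 (progSection 6 5 (schurSeries 9))) by
    rw [progSection_comp, progSection_comp]]
  have : Fact (Nat.Prime 2) := ⟨Nat.prime_two⟩
  obtain ⟨Y, hY⟩ := natCast_dvd_pow_sub_expand 2 (theta (-1) 1 2)
  rw [Nat.cast_ofNat, sub_eq_iff_eq_add] at hY
  obtain ⟨T, hT⟩ := two_dvd_theta_one_one_sub_one (-1)
  obtain ⟨S, hS⟩ := two_dvd_theta_sub_theta 1 (-1) 1 5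
  have e1 := expand_theta 2 two_ne_zero (-1) (b := 1) (c := 2) (by norm_num) (by norm_num)
  have e2 := expand_theta 2 two_ne_zero 1 (b := 4) (c := 8) (by norm_num) (by norm_num)
  have e3 := expand_theta 2 two_ne_zero 1 (b := 2) (c := 10) (by norm_num) (by norm_num)
  have e4 := expand_theta 2 two_ne_zero 1 (b := 2) (c := 4) (by norm_num) (by norm_num)
  have e5 := expand_theta 2 two_ne_zero 1 (b := 1) (c := 5) (by norm_num) (by norm_num)
  norm_num at e1 e2 e3 e4 e5
  have hn : ∀ (a r k : ℕ) (A : ℤ⟦X⟧), progSection a r ((k : ℤ⟦X⟧) * A) = k * progSection a r A :=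
    fun a r k A => progSection_natCast_mul a r k A
  have hn2 := fun a r => hn a r 2
  have hn8 := fun a r => hn a r 8
  have hn32 := fun a r => hn a r 32
  simp only [Nat.cast_ofNat] at hn2 hn8 hn32
  have h1 : progSection 2 1 ((theta (-1) 2 4 * theta (-1) 1 5) ^ 2) =
      -(2 * (theta (-1) 1 2 ^ 2 * theta 1 4 8 * theta 1 2 10)) := by
    rw [theta_one_five_two_dissection, ← e1, ← e2, ← e3]
    have : ∀ a b c : ℤ⟦X⟧, (expand 2 two_ne_zero a * (expand 2 two_ne_zero b -
        X * expand 2 two_ne_zero c)) ^ 2 = expand 2 two_ne_zero ((a * b) ^ 2) +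
        X * (X * expand 2 two_ne_zero ((a * c) ^ 2)) -
        X * expand 2 two_ne_zero (2 * (a ^ 2 * b * c)) := by
      intro a b c
      simp only [map_mul, map_ofNat, map_pow]
      ring
    rw [this]
    have hx1 := progSection_X_mul 2 0
    norm_num at hx1
    simp only [map_sub, LinearMap.map_add, hx1, progSection_X_mul_zero two_pos,
      progSection_expand, Nat.reduceSub]
    simp only [progSection_expand_of_pos two_ne_zero one_lt_two one_pos]
    ring
  have h2 : progSection 2 0 (theta (-1) 1 2 ^ 2 * theta 1 4 8 * theta 1 2 10) =
      theta (-1) 1 2 * theta 1 2 4 * theta 1 1 5 + 2 * progSection 2 0 (Y * theta 1 4 8 * theta 1 2 10)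
      := by
    rw [hY, ← hn2, ← progSection_expand two_ne_zero (theta (-1) 1 2 * theta 1 2 4 * theta 1 1 5),
      ← LinearMap.map_add]
    simp only [map_mul, e4, e5]
    congr 1; ring
  rw [sub_eq_iff_eq_add] at hZ
  rw [hZ, LinearMap.map_add, hn32, hn8, h1, LinearMap.map_add, hn32, hn8, LinearMap.map_neg, hn2, h2]
  have h3 := euler_mul_theta_one_five
  rw [sub_eq_iff_eq_add] at hT hS
  rw [hT] at h3
  rw [hS]
  generalize progSection 2 0 (Y * theta 1 4 8 * theta 1 2 10) = Q
  generalize progSection 2 0 (progSection 2 1 Z) = P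
  refine ⟨P - Q - theta 1 2 4 * (theta 1 3 9 + T * theta 1 3 9 + theta (-1) 1 2 * S), ?_⟩
  linear_combination (-16 * theta 1 2 4) * h3

/-! ### From tuples to single overpartitions -/

theorem two_dvd_schurSeries_nine_sub_one : (2 : ℤ⟦X⟧) ∣ schurSeries 9 - 1 := by
  obtain ⟨U, V, -, -, hF⟩ := schurSeries_nine_identity
  exact ⟨X * expand 3 (by norm_num) U + schurSeries 9 * X ^ 2 * expand 6 (by norm_num) V,
    by linear_combination hF⟩

/-- Each squaring of 1 + 2^(k+1) Z gains one more factor 2. -/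
theorem two_pow_dvd_pow_two_pow_sub_one {R : Type*} [CommRing R] {A : R} (h : (2 : R) ∣ A - 1)
    (k : ℕ) : (2 : R) ^ (k + 1) ∣ A ^ 2 ^ k - 1 := by
  induction k with
  | zero => simpa using h
  | succ k ih =>
    obtain ⟨Z, hZ⟩ := ih
    rw [sub_eq_iff_eq_add] at hZ
    rw [pow_succ 2 k, pow_mul, hZ]
    exact ⟨2 ^ k * 2 * Z ^ 2 + Z - 2 ^ k * Z ^ 2, by ring⟩

theorem two_pow_dvd_pow_sub_self {R : Type*} [CommRing R] {A : R} (h : (2 : R) ∣ A - 1)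
    (k m : ℕ) : (2 : R) ^ (k + 1) ∣ A ^ (2 ^ k * m + 1) - A := by
  have h1 : A ^ (2 ^ k * m + 1) - A = A * ((A ^ 2 ^ k) ^ m - 1 ^ m) := by
    rw [pow_succ, pow_mul, one_pow]; ring
  rw [h1]
  exact ((two_pow_dvd_pow_two_pow_sub_one h k).trans (sub_dvd_pow_sub_pow _ _ m)).mul_left _

theorem numSchurOverpartitionTuples_nine_modEq (k m n : ℕ) :
    (2 : ℤ) ^ (k + 1) ∣ numSchurOverpartitionTuples 9 (2 ^ k * m + 1) n - coeff n (schurSeries 9) := by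
  rw [← coeff_schurSeries_pow, ← map_sub]
  have h := two_pow_dvd_pow_sub_self two_dvd_schurSeries_nine_sub_one k m
  have h2 : ((2 ^ (k + 1) : ℕ) : ℤ⟦X⟧) = 2 ^ (k + 1) := by push_cast; rfl
  rw [← h2, natCast_dvd_iff] at h
  simpa using h n

theorem dvd_coeff_of_dvd_progSection_sub {N a r c k : ℕ} {A B : ℤ⟦X⟧}
    (h : (N : ℤ⟦X⟧) ∣ progSection a r A - (c : ℤ⟦X⟧) * B) (hB : coeff k B = 0) :
    (N : ℤ) ∣ coeff (a * k + r) A := by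
  have := natCast_dvd_iff.mp h k
  rwa [map_sub, coeff_progSection, ← nsmul_eq_mul, map_nsmul, hB, smul_zero, sub_zero] at this

/-! ### Vanishing of theta coefficients by quadratic forms -/

section Vanishing

variable {p : ℕ} [Fact p.Prime]

/-- Since -D is a nonresidue, p dividing x² + Dy² forces p to divide x and y. Dividing by p² lowers
the odd exponent by 2 until p would have to divide c. -/
theorem sq_add_mul_sq_ne {D : ℤ} (hD : legendreSym p (-D) = -1) {c : ℤ} (hc : ¬ (p : ℤ) ∣ c)
    (α : ℕ) (x y : ℤ) : x ^ 2 + D * y ^ 2 ≠ c * p ^ (2 * α + 1) := by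
  have hp0 : (p : ℤ) ≠ 0 := by exact_mod_cast (Fact.out : p.Prime).ne_zero
  induction α generalizing x y with
  | zero =>
    intro h
    obtain ⟨⟨x', rfl⟩, ⟨y', rfl⟩⟩ := legendreSym.prime_dvd_of_eq_neg_one hD
      (x := x) (y := y) ⟨c, by linear_combination h⟩
    exact hc ⟨x' ^ 2 + D * y' ^ 2, mul_left_cancel₀ hp0 (by linear_combination -h)⟩
  | succ α ih =>
    intro h
    obtain ⟨⟨x', rfl⟩, ⟨y', rfl⟩⟩ := legendreSym.prime_dvd_of_eq_neg_one hD
      (x := x) (y := y) ⟨c * p ^ (2 * α + 2), by linear_combination h⟩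
    exact ih x' y' (mul_left_cancel₀ (pow_ne_zero 2 hp0) (by linear_combination h))

theorem not_dvd_smooth_mul_add (hp : 5 ≤ p) {i : ℕ} (hi : i ∈ Finset.Icc 1 (p - 1)) (a b : ℕ)
    (z : ℤ) : ¬ (p : ℤ) ∣ 2 ^ a * 3 ^ b * i + p * z := by
  have hpp : p.Prime := Fact.out
  intro h
  rw [Int.dvd_add_left (dvd_mul_right _ _)] at h
  have h' : p ∣ 2 ^ a * 3 ^ b * i := by exact_mod_cast h
  rw [Finset.mem_Icc] at hi
  rcases hpp.dvd_mul.mp h' with h | h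
  · rcases hpp.dvd_mul.mp h with h | h
    · have := Nat.le_of_dvd two_pos (hpp.dvd_of_dvd_pow h); omega
    · have := Nat.le_of_dvd three_pos (hpp.dvd_of_dvd_pow h); omega
  · have := Nat.le_of_dvd (by omega) h; omega

/-- The number s absorbs the constants created by completing squares, so that the coefficient
indices below are natural numbers without division. -/
theorem exists_pow_eq_twentyFour_mul_add_one (hp : 5 ≤ p) (α : ℕ) :
    ∃ s, p ^ (2 * α + 2) = 24 * s + 1 := by
  have hpp : p.Prime := Fact.out
  have h2 : p % 2 ≠ 0 := fun h => by
    have := (Nat.prime_dvd_prime_iff_eq Nat.prime_two hpp).mp (Nat.dvd_of_mod_eq_zero h); omega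
  have h3 : p % 3 ≠ 0 := fun h => by
    have := (Nat.prime_dvd_prime_iff_eq Nat.prime_three hpp).mp (Nat.dvd_of_mod_eq_zero h); omega
  have h24 : p ^ 2 ≡ 1 [MOD 24] := by
    have : p % 24 < 24 := Nat.mod_lt _ (by norm_num)
    have h2' : p % 24 % 2 ≠ 0 := by omega
    have h3' : p % 24 % 3 ≠ 0 := by omega
    rw [Nat.ModEq, Nat.pow_mod]
    generalize p % 24 = r at *
    interval_cases r <;> first | rfl | omega
  have h : p ^ (2 * α + 2) ≡ 1 [MOD 24] := by
    rw [show 2 * α + 2 = 2 * (α + 1) by ring, pow_mul]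
    simpa using h24.pow (α + 1)
  refine ⟨p ^ (2 * α + 2) / 24, ?_⟩
  have h' : p ^ (2 * α + 2) % 24 = 1 := h
  omega

/-- A square root r of -3 would give the primitive cube root of unity (r - 1)/2, so 3 would divide p
- 1. -/
theorem legendreSym_neg_three_of_modEq (h : p ≡ 5 [MOD 6]) : legendreSym p (-3) = -1 := by
  have hpp : p.Prime := Fact.out
  have h5 : p % 6 = 5 := h
  rw [legendreSym.eq_neg_one_iff]
  rintro ⟨r, hr⟩
  push_cast at hr
  have h2 : (2 : ZMod p) ≠ 0 := by
    intro h0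
    have : ((2 : ℕ) : ZMod p) = 0 := by exact_mod_cast h0
    rw [ZMod.natCast_eq_zero_iff] at this
    have := Nat.le_of_dvd two_pos this; omega
  have h3 : (3 : ZMod p) ≠ 0 := by
    intro h0
    have : ((3 : ℕ) : ZMod p) = 0 := by exact_mod_cast h0
    rw [ZMod.natCast_eq_zero_iff] at this
    have := (Nat.prime_dvd_prime_iff_eq hpp Nat.prime_three).mp this; omega
  set w : ZMod p := (r - 1) / 2 with hw
  have hw2 : 2 * w = r - 1 := by rw [hw]; field_simp
  have hq : w ^ 2 + w + 1 = 0 := by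
    apply mul_left_cancel₀ (mul_ne_zero h2 h2)
    linear_combination (2 * w + r + 1) * hw2 - hr
  have hw3 : w ^ 3 = 1 := by linear_combination (w - 1) * hq
  have hw1 : w ≠ 1 := by
    intro h1
    rw [h1] at hq
    exact h3 (by linear_combination hq)
  have : Fact (Nat.Prime 3) := ⟨Nat.prime_three⟩
  have ho := orderOf_eq_prime hw3 hw1
  have hw0 : w ≠ 0 := by
    intro h0
    rw [h0] at hw3
    norm_num at hw3
  have hd := orderOf_dvd_of_pow_eq_one (ZMod.pow_card_sub_one_eq_one hw0)
  rw [ho] at hd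
  omega

theorem coeff_euler_mul_gauss_eq_zero (hp : 5 ≤ p) (hD : legendreSym p (-3) = -1) {i : ℕ}
    (hi : i ∈ Finset.Icc 1 (p - 1)) {α s : ℕ} (hs : p ^ (2 * α + 2) = 24 * s + 1) (n : ℕ) :
    coeff (p ^ (2 * α + 1) * (p * n + i) + 4 * s) (theta (-1) 1 2 * theta 1 1 3) = 0 := by
  apply ((isThetaSum_theta (-1) one_pos two_pos).mul
    (isThetaSum_theta 1 one_pos three_pos)).coeff_eq_zero
  rintro ⟨u, v⟩ h
  have h1 := two_mul_thetaExp 1 2 u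
  have h2 := two_mul_thetaExp 1 3 v
  have hs' : (p : ℤ) ^ (2 * α + 2) = 24 * s + 1 := by exact_mod_cast hs
  push_cast at h h1 h2
  -- Scaling the exponent by 24 and adding 4 gives (6u - 1)² + 3(4v - 1)². The three lemmas that
  -- follow use the scalings 8, 48 and 108 in the same way.
  refine sq_add_mul_sq_ne hD (c := 2 ^ 3 * 3 ^ 1 * i + p * (24 * n + 4))
    (not_dvd_smooth_mul_add hp hi 3 1 _) α (6 * u - 1) (4 * v - 1) ?_
  linear_combination 24 * h - 12 * h1 - 12 * h2 - 4 * hs'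

theorem coeff_gauss_mul_gauss_eq_zero (hp : 5 ≤ p) (hD : legendreSym p (-3) = -1) {i : ℕ}
    (hi : i ∈ Finset.Icc 1 (p - 1)) {α s : ℕ} (hs : p ^ (2 * α + 2) = 24 * s + 1) (n : ℕ) :
    coeff (p ^ (2 * α + 1) * (p * n + i) + 12 * s) (theta 1 1 3 * theta 1 3 9) = 0 := by
  apply ((isThetaSum_theta 1 one_pos three_pos).mul
    (isThetaSum_theta 1 (b := 3) (c := 9) (by norm_num) (by norm_num))).coeff_eq_zero
  rintro ⟨u, v⟩ h
  have h1 := two_mul_thetaExp 1 3 u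
  have h2 := two_mul_thetaExp 3 9 v
  have hs' : (p : ℤ) ^ (2 * α + 2) = 24 * s + 1 := by exact_mod_cast hs
  push_cast at h h1 h2
  refine sq_add_mul_sq_ne hD (c := 2 ^ 3 * 3 ^ 0 * i + p * (8 * n + 4))
    (not_dvd_smooth_mul_add hp hi 3 0 _) α (4 * u - 1) (4 * v - 1) ?_
  linear_combination 8 * h - 4 * h1 - 4 * h2 - 4 * hs'

theorem coeff_theta_two_four_mul_theta_three_nine_eq_zero (hp : 5 ≤ p)
    (hD : legendreSym p (-18) = -1) {i : ℕ} (hi : i ∈ Finset.Icc 1 (p - 1)) {α s : ℕ}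
    (hs : p ^ (2 * α + 2) = 24 * s + 1) (n : ℕ) :
    coeff (p ^ (2 * α + 1) * (p * n + i) + 11 * s) (theta 1 2 4 * theta 1 3 9) = 0 := by
  apply ((isThetaSum_theta 1 (b := 2) (c := 4) (by norm_num) (by norm_num)).mul
    (isThetaSum_theta 1 (b := 3) (c := 9) (by norm_num) (by norm_num))).coeff_eq_zero
  rintro ⟨u, v⟩ h
  have h1 := two_mul_thetaExp 2 4 u
  have h2 := two_mul_thetaExp 3 9 v
  have hs' : (p : ℤ) ^ (2 * α + 2) = 24 * s + 1 := by exact_mod_cast hs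
  push_cast at h h1 h2
  refine sq_add_mul_sq_ne hD (c := 2 ^ 4 * 3 ^ 1 * i + p * (48 * n + 22))
    (not_dvd_smooth_mul_add hp hi 4 1 _) α (2 * (6 * u - 1)) (4 * v - 1) ?_
  linear_combination 48 * h - 24 * h1 - 24 * h2 - 22 * hs'

theorem coeff_theta_two_four_mul_theta_one_five_eq_zero (hp : 5 ≤ p)
    (hD : legendreSym p (-9) = -1) {i : ℕ} (hi : i ∈ Finset.Icc 1 (p - 1)) {α s : ℕ}
    (hs : p ^ (2 * α + 2) = 24 * s + 1) (n : ℕ) :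
    coeff (p ^ (2 * α + 1) * (p * n + i) + 10 * s) (theta (-1) 2 4 * theta (-1) 1 5) = 0 := by
  apply ((isThetaSum_theta (-1) (b := 2) (c := 4) (by norm_num) (by norm_num)).mul
    (isThetaSum_theta (-1) (b := 1) (c := 5) (by norm_num) (by norm_num))).coeff_eq_zero
  rintro ⟨u, v⟩ h
  have h1 := two_mul_thetaExp 2 4 u
  have h2 := two_mul_thetaExp 1 5 v
  have hs' : (p : ℤ) ^ (2 * α + 2) = 24 * s + 1 := by exact_mod_cast hs
  push_cast at h h1 h2
  -- The natural form is 4(3v - 1)² + (6u - 1)²; multiplying it by 9 and attaching the 9 to the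
  -- second square produces D = 9.
  refine sq_add_mul_sq_ne hD (c := 2 ^ 2 * 3 ^ 3 * i + p * (108 * n + 45))
    (not_dvd_smooth_mul_add hp hi 2 3 _) α (6 * (3 * v - 1)) (6 * u - 1) ?_
  linear_combination 108 * h - 54 * h1 - 54 * h2 - 45 * hs'

end Vanishing

/-! ### Assembling the five congruences -/

theorem numSchurOverpartitionTuples_modEq_zero {k m n a : ℕ}
    (h : ((2 ^ (k + 1) : ℕ) : ℤ) ∣ coeff n (schurSeries 9)) (ha : a = 2 ^ k * m + 1) :
    numSchurOverpartitionTuples 9 a n ≡ 0 [MOD 2 ^ (k + 1)] := by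
  rw [Nat.modEq_zero_iff_dvd, ← Int.natCast_dvd_natCast, ha]
  have h1 := numSchurOverpartitionTuples_nine_modEq k m n
  push_cast at h ⊢
  exact (dvd_sub_left h).mp h1

theorem theorem3 (p : ℕ) [Fact p.Prime] (hp : 5 ≤ p) :
    (p ≡ 5 [MOD 6] →
      ∀ α n : ℕ, ∀ i ∈ Finset.Icc 1 (p - 1),
        numSchurOverpartitions 9
          (6 * p ^ (2 * α + 2) * n + (6 * i + 3 * p) * p ^ (2 * α + 1)) ≡ 0 [MOD 3]) ∧
    (legendreSym p (-18) = -1 →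
      ∀ m α n : ℕ, ∀ i ∈ Finset.Icc 1 (p - 1),
        numSchurOverpartitionTuples 9 (16 * m + 1)
          (24 * p ^ (2 * α + 2) * n + (24 * i + 11 * p) * p ^ (2 * α + 1)) ≡ 0 [MOD 32]) ∧
    (legendreSym p (-3) = -1 →
      ∀ m α n : ℕ, ∀ i ∈ Finset.Icc 1 (p - 1),
        numSchurOverpartitionTuples 9 (8 * m + 1)
          (18 * p ^ (2 * α + 2) * n + 3 * (6 * i + p) * p ^ (2 * α + 1)) ≡ 0 [MOD 16]) ∧
    (legendreSym p (-9) = -1 →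
      ∀ m α n : ℕ, ∀ i ∈ Finset.Icc 1 (p - 1),
        numSchurOverpartitionTuples 9 (8 * m + 1)
          (12 * p ^ (2 * α + 2) * n + (12 * i + 5 * p) * p ^ (2 * α + 1)) ≡ 0 [MOD 16]) ∧
    (legendreSym p (-3) = -1 →
      ∀ m α n : ℕ, ∀ i ∈ Finset.Icc 1 (p - 1),
        numSchurOverpartitionTuples 9 (4 * m + 1)
          (6 * p ^ (2 * α + 2) * n + (6 * i + p) * p ^ (2 * α + 1)) ≡ 0 [MOD 8]) := by
  refine ⟨fun h5 α n i hi => ?_, fun hD m α n i hi => ?_, fun hD m α n i hi => ?_,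
    fun hD m α n i hi => ?_, fun hD m α n i hi => ?_⟩ <;>
    obtain ⟨s, hs⟩ := exists_pow_eq_twentyFour_mul_add_one hp α
  · have h := dvd_coeff_of_dvd_progSection_sub (N := 3) (c := 1)
      (by simpa using progSection_six_three_modEq_three)
      (coeff_gauss_mul_gauss_eq_zero hp (legendreSym_neg_three_of_modEq h5) hi hs n)
    rw [schurSeries, coeff_mk, Int.natCast_dvd_natCast] at h
    rw [Nat.modEq_zero_iff_dvd]
    convert h using 2
    linear_combination 3 * hs
  · refine numSchurOverpartitionTuples_modEq_zero (k := 4) ?_ rfl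
    have h := dvd_coeff_of_dvd_progSection_sub (N := 32) (c := 16)
      progSection_twentyFour_eleven_modEq_thirtyTwo
      (coeff_theta_two_four_mul_theta_three_nine_eq_zero hp hD hi hs n)
    convert h using 2
    · norm_num
    · congr 1; linear_combination 11 * hs
  · refine numSchurOverpartitionTuples_modEq_zero (k := 3) ?_ rfl
    have h := dvd_coeff_of_dvd_progSection_sub (N := 16) (c := 4)
      progSection_eighteen_three_modEq_sixteen (coeff_euler_mul_gauss_eq_zero hp hD hi hs n)
    convert h using 2
    · norm_num
    · congr 1; linear_combination 3 * hs
  · refine numSchurOverpartitionTuples_modEq_zero (k := 3) ?_ rfl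
    have h := dvd_coeff_of_dvd_progSection_sub (N := 16) (c := 8)
      progSection_six_five_modEq_sixteen
      -- The section is congruent to a series in X², so the progression 12n + 5 is reached at even
      -- positions of the section 6n + 5.
      (k := 2 * (p ^ (2 * α + 1) * (p * n + i) + 10 * s))
      (by rw [coeff_expand_mul, coeff_theta_two_four_mul_theta_one_five_eq_zero hp hD hi hs n])
    convert h using 2
    · norm_num
    · congr 1; linear_combination 5 * hs
  · refine numSchurOverpartitionTuples_modEq_zero (k := 2) ?_ rfl
    have h := dvd_coeff_of_dvd_progSection_sub (N := 8) (c := 2)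
      progSection_six_one_modEq_eight (coeff_euler_mul_gauss_eq_zero hp hD hi hs n)
    convert h using 2
    · norm_num
    · congr 1; linear_combination hs
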